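/- Let $n\ge 3$, write $x=(x',x_n)$ with $x'\in\mathbb R^{n-1}$, and let $D_{x_i}$ denote the partial derivative in $x_i$. Put $$\Gamma(x,t)=(2\pi t)^{-n/2}e^{-|x|^2/(2t)}\ (t>0),\qquad \Gamma(x,t)=0\ (t\le 0),\qquad E(x)=-\frac{1}{(n-2)\omega_n}|x|^{2-n},$$ where $\omega_n$ is the surface area of the unit sphere in $\mathbb R^n$. For $x_n>0$, $t>0$ and $1\le i,j\le n$ define $$L_{ij}(x,t)=D_{x_j}\int_0^{x_n}\int_{\mathbb R^{n-1}}D_{z_n}\Gamma(z,t)\,D_{x_i}E(x-z)\,dz'\,dz_n,$$ $$\kappa(x,t)=\int_{\mathbb R^{n-1}}D_{x_n}\Gamma(x'-z',x_n,t)\,E(z',0)\,dz',\qquad B_{in}=D_{x_i}\kappa\ \ (i\ne n),\qquad B_{nn}=0 .$$ These integrals converge absolutely and the partial derivatives exist for all $x_n>0$, $t>0$. Moreover there is a constant $C>0$, depending only on $n$, such that for every $x_n>0$ the functions $L_{ij}(\cdot,x_n,\cdot)$ ($1\le i\le n$, $1\le j\le n-1$) and $L_{in}(\cdot,x_n,\cdot)-B_{in}(\cdot,x_n,\cdot)$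 ($1\le i\le n$) belong to $L^1(\mathbb R^{n-1}\times(0,\infty))$ and $$\int_0^\infty\!\int_{\mathbb R^{n-1}}|L_{ij}(x',x_n,t)|\,dx'\,dt<C\qquad(1\le i\le n,\ 1\le j\le n-1),$$ $$\int_0^\infty\!\int_{\mathbb R^{n-1}}|L_{in}(x',x_n,t)-B_{in}(x',x_n,t)|\,dx'\,dt<C\qquad(1\le i\le n).$$ -/

import Mathlib

open MeasureTheory Set

namespace StokesHalfSpace

noncomputable section

/-- The surface area `ω_n` of the unit sphere of `ℝⁿ`. -/
def sphereArea (n : ℕ) : ℝ :=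
  (volume : Measure (EuclideanSpace ℝ (Fin n))).toSphere.real univ

/-- The Gaussian kernel `Γ(x,t) = (2πt)^{-n/2} exp(-|x|²/(2t))` for `t > 0`, and `0` for `t ≤ 0`. -/
def heatKernel {n : ℕ} (x : EuclideanSpace ℝ (Fin n)) (t : ℝ) : ℝ :=
  if 0 < t then 1 / Real.sqrt (2 * Real.pi * t) ^ n * Real.exp (-‖x‖ ^ 2 / (2 * t)) else 0

/-- The fundamental solution of the Laplace equation in `ℝⁿ`, `n ≥ 3`:
`E(x) = -|x|^{2-n} / ((n-2) ω_n)`, so that `ΔE = δ`. -/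
def laplaceFund {n : ℕ} (x : EuclideanSpace ℝ (Fin n)) : ℝ :=
  -(1 / (((n : ℝ) - 2) * sphereArea n)) * ‖x‖ ^ ((2 : ℤ) - n)

/-- The `i`-th standard basis vector of `ℝⁿ`. -/
def stdVec {n : ℕ} (i : Fin n) : EuclideanSpace ℝ (Fin n) :=
  EuclideanSpace.single i (1 : ℝ)

/-- The partial derivative `D_{x_i} f (x)`. -/
def pderiv {n : ℕ} (i : Fin n) (f : EuclideanSpace ℝ (Fin n) → ℝ)
    (x : EuclideanSpace ℝ (Fin n)) : ℝ :=
  lineDeriv ℝ f x (stdVec i)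

/-! In what follows the space dimension is `n = d + 1`; the tangential indices `1, …, n-1` are the
`Fin.castSucc j` with `j : Fin d`, and the normal index `n` is `Fin.last d`. -/

/-- The point `(x', s)` of `ℝⁿ = ℝⁿ⁻¹ × ℝ`. -/
def join {d : ℕ} (x' : EuclideanSpace ℝ (Fin d)) (s : ℝ) : EuclideanSpace ℝ (Fin (d + 1)) :=
  WithLp.toLp 2 (Fin.snoc (α := fun _ => ℝ) (fun k => x' k) s)

/-- The tangential part `x' = (x_1, …, x_{n-1})` of `x`. -/
def tang {d : ℕ} (x : EuclideanSpace ℝ (Fin (d + 1))) : EuclideanSpace ℝ (Fin d) :=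
  WithLp.toLp 2 (fun k => x k.castSucc)

/-- The integrand `D_{z_n} Γ(z,t) D_{x_i} E(x - z)`. -/
def stripIntegrand {d : ℕ} (i : Fin (d + 1)) (x : EuclideanSpace ℝ (Fin (d + 1))) (t : ℝ)
    (z : EuclideanSpace ℝ (Fin (d + 1))) : ℝ :=
  pderiv (Fin.last d) (fun y => heatKernel y t) z * pderiv i laplaceFund (x - z)

/-- `∫_0^{x_n} ∫_{ℝⁿ⁻¹} D_{z_n} Γ(z,t) D_{x_i} E(x - z) dz' dz_n`. -/
def stripPotential {d : ℕ} (i : Fin (d + 1)) (x : EuclideanSpace ℝ (Fin (d + 1))) (t : ℝ) : ℝ :=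
  ∫ s in (0 : ℝ)..(x (Fin.last d)), ∫ z' : EuclideanSpace ℝ (Fin d),
    stripIntegrand i x t (join z' s)

/-- The half-space kernel
`L_{ij}(x,t) = D_{x_j} ∫_0^{x_n} ∫_{ℝⁿ⁻¹} D_{z_n} Γ(z,t) D_{x_i} E(x - z) dz`. -/
def kernelL {d : ℕ} (i j : Fin (d + 1)) (x : EuclideanSpace ℝ (Fin (d + 1))) (t : ℝ) : ℝ :=
  pderiv j (fun y => stripPotential i y t) x

/-- The integrand `D_{x_n} Γ(x' - z', x_n, t) E(z', 0)`. -/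
def kappaIntegrand {d : ℕ} (x : EuclideanSpace ℝ (Fin (d + 1))) (t : ℝ)
    (z' : EuclideanSpace ℝ (Fin d)) : ℝ :=
  pderiv (Fin.last d) (fun y => heatKernel y t) (join (tang x - z') (x (Fin.last d))) *
    laplaceFund (join z' 0)

/-- The composite kernel `κ(x,t) = ∫_{ℝⁿ⁻¹} D_{x_n} Γ(x' - z', x_n, t) E(z', 0) dz'`. -/
def kappa {d : ℕ} (x : EuclideanSpace ℝ (Fin (d + 1))) (t : ℝ) : ℝ :=
  ∫ z' : EuclideanSpace ℝ (Fin d), kappaIntegrand x t z'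

/-- `B_{in} = D_{x_i} κ` for `i ≠ n`, and `B_{nn} = 0`. -/
def kernelB {d : ℕ} (i : Fin (d + 1)) (x : EuclideanSpace ℝ (Fin (d + 1))) (t : ℝ) : ℝ :=
  if i = Fin.last d then 0 else pderiv i (fun y => kappa y t) x

end

end StokesHalfSpace

/-! Write `n = d + 1`. Since `Γ(z,t)` is the product of a one-dimensional Gaussian in `z_n` and a
Gaussian on `ℝ^d`, the substitution `s ↦ x_n - s` turns the strip potential into a Volterra
convolution `∫_0^X Γ₁'(X - s) m_i(s) ds`, with `X = x_n`, `Γ₁ = gaussN` and `m_i(s) = gradConv i`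
the tangential convolution of the Gaussian with `D_i E(·, s)` (`stripPotential_eq`). Now `E` is
evaluated only at heights `s > 0`, and `x` enters through Gaussians and the upper limit alone.

A tangential derivative `D_j` falls on the tangential Gaussian and gives `tangKernel i j`. Its `L¹`
bound is the heart of the matter (`lintegral_tangKernel_le`). As `D_jΓ` has mean zero, `D_i E(y, s)`
can be subtracted inside the convolution. A Hölder-`1/2` estimate for `∇E` (`abs_gradE_sub_le`) then
gives a norm over `y` of order `t^{-1/4} s^{-1/2}`; integrating against `|Γ₁'(X - s, t)|` in `t`
leaves `(X - s)^{-1/2} s^{-1/2}`, and the integral of this over `(0, X)` does not depend on `X`.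

A normal derivative produces `Γ₁''(X - s)`, without a boundary term because `Γ₁'(0) = 0`
(`hasDerivAt_volterra`). Integration by parts in `s` (`volterra_parts`) puts one derivative back on
`m_i` and creates the boundary term `Γ₁'(X) m_i(0+)`. If `i ≠ n`, this term is exactly `B_{in}`, and
the rest is `tangKernel n i` (`kernelL_sub_kernelB_castSucc`). If `i = n`, harmonicity of `E`
replaces `D_n²E` by `-∑_k D_k²E`, so the rest is a sum of tangential kernels; the boundary term is a
multiple of `D_nΓ`, because `D_nE(·, s)` is a multiple of the Poisson kernel, and it is itself in
`L¹` uniformly in `X` (`kernelL_last_last`, `lintegral_heat_le`). -/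

namespace StokesHalfSpace

noncomputable section

open Filter Topology

/-! ### Splitting off the normal coordinate -/

section Coordinates

variable {d : ℕ}

@[simp] lemma join_castSucc (w : EuclideanSpace ℝ (Fin d)) (s : ℝ) (j : Fin d) :
    join w s j.castSucc = w j := by
  simp [join]

@[simp] lemma join_last (w : EuclideanSpace ℝ (Fin d)) (s : ℝ) :
    join w s (Fin.last d) = s := by
  simp [join]

@[simp] lemma tang_apply (x : EuclideanSpace ℝ (Fin (d + 1))) (j : Fin d) :
    tang x j = x j.castSucc := rfl

lemma norm_join_sq (w : EuclideanSpace ℝ (Fin d)) (s : ℝ) :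
    ‖join w s‖ ^ 2 = ‖w‖ ^ 2 + s ^ 2 := by
  simp [EuclideanSpace.norm_sq_eq, Fin.sum_univ_castSucc]

lemma join_tang (x : EuclideanSpace ℝ (Fin (d + 1))) : join (tang x) (x (Fin.last d)) = x := by
  ext k
  refine Fin.lastCases ?_ (fun j => ?_) k <;> simp

@[simp] lemma tang_join (w : EuclideanSpace ℝ (Fin d)) (s : ℝ) : tang (join w s) = w := by
  ext k; simp

lemma sub_join (x : EuclideanSpace ℝ (Fin (d + 1))) (z : EuclideanSpace ℝ (Fin d)) (s : ℝ) :
    x - join z s = join (tang x - z) (x (Fin.last d) - s) := by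
  ext k
  refine Fin.lastCases ?_ (fun j => ?_) k <;> simp

lemma join_sub_join (w z : EuclideanSpace ℝ (Fin d)) (r s : ℝ) :
    join w r - join z s = join (w - z) (r - s) := by
  simp [sub_join]

lemma join_add_smul_castSucc (w : EuclideanSpace ℝ (Fin d)) (s r : ℝ) (j : Fin d) :
    join w s + r • stdVec j.castSucc = join (w + r • stdVec j) s := by
  ext k
  refine Fin.lastCases ?_ (fun i => ?_) k
  · simp [stdVec, (Fin.castSucc_lt_last j).ne]
  · simp [stdVec]

lemma join_add_smul_last (w : EuclideanSpace ℝ (Fin d)) (s r : ℝ) :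
    join w s + r • stdVec (Fin.last d) = join w (s + r) := by
  ext k
  refine Fin.lastCases ?_ (fun i => ?_) k
  · simp [stdVec]
  · simp [stdVec, (Fin.castSucc_lt_last i).ne]

lemma tang_add_smul_castSucc (x : EuclideanSpace ℝ (Fin (d + 1))) (r : ℝ) (j : Fin d) :
    tang (x + r • stdVec j.castSucc) = tang x + r • stdVec j := by
  rw [← join_tang x, join_add_smul_castSucc, tang_join, tang_join]

lemma last_add_smul_castSucc (x : EuclideanSpace ℝ (Fin (d + 1))) (r : ℝ) (j : Fin d) :
    (x + r • stdVec j.castSucc) (Fin.last d) = x (Fin.last d) := by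
  rw [← join_tang x, join_add_smul_castSucc, join_last, join_last]

lemma tang_add_smul_last (x : EuclideanSpace ℝ (Fin (d + 1))) (r : ℝ) :
    tang (x + r • stdVec (Fin.last d)) = tang x := by
  rw [← join_tang x, join_add_smul_last, tang_join, tang_join]

lemma last_add_smul_last (x : EuclideanSpace ℝ (Fin (d + 1))) (r : ℝ) :
    (x + r • stdVec (Fin.last d)) (Fin.last d) = x (Fin.last d) + r := by
  rw [← join_tang x, join_add_smul_last, join_last, join_last]

lemma continuous_join :
    Continuous (fun p : EuclideanSpace ℝ (Fin d) × ℝ => join p.1 p.2) := by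
  refine (PiLp.continuous_toLp 2 _).comp (continuous_pi fun k => ?_)
  refine Fin.lastCases ?_ (fun i => ?_) k
  · simpa using continuous_snd
  · simp only [Fin.snoc_castSucc]
    fun_prop

@[fun_prop]
lemma Continuous.join {X : Type*} [TopologicalSpace X] {f : X → EuclideanSpace ℝ (Fin d)}
    {g : X → ℝ} (hf : Continuous f) (hg : Continuous g) :
    Continuous fun a => StokesHalfSpace.join (f a) (g a) :=
  continuous_join.comp (hf.prodMk hg)

@[fun_prop]
lemma Measurable.join {X : Type*} [MeasurableSpace X] {f : X → EuclideanSpace ℝ (Fin d)}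
    {g : X → ℝ} (hf : Measurable f) (hg : Measurable g) :
    Measurable fun a => StokesHalfSpace.join (f a) (g a) :=
  continuous_join.measurable.comp (hf.prodMk hg)

lemma abs_le_norm_join (w : EuclideanSpace ℝ (Fin d)) (s : ℝ) : |s| ≤ ‖join w s‖ := by
  rw [← abs_of_nonneg (norm_nonneg (join w s))]
  refine sq_le_sq.1 ?_
  rw [norm_join_sq]
  nlinarith [sq_nonneg ‖w‖]

lemma norm_le_norm_join (w : EuclideanSpace ℝ (Fin d)) (s : ℝ) : ‖w‖ ≤ ‖join w s‖ := by
  refine le_of_sq_le_sq ?_ (norm_nonneg _)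
  rw [norm_join_sq]
  nlinarith [sq_nonneg s]

lemma norm_join_pos (w : EuclideanSpace ℝ (Fin d)) {s : ℝ} (hs : 0 < s) : 0 < ‖join w s‖ :=
  hs.trans_le ((le_abs_self s).trans (abs_le_norm_join w s))

lemma norm_join_zero (w : EuclideanSpace ℝ (Fin d)) : ‖join w 0‖ = ‖w‖ := by
  have := norm_join_sq w 0
  rw [zero_pow two_ne_zero, add_zero] at this
  exact (pow_left_inj₀ (norm_nonneg _) (norm_nonneg _) two_ne_zero).1 this

lemma norm_stdVec {n : ℕ} (j : Fin n) : ‖stdVec j‖ = 1 := by simp [stdVec]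

/-- A line derivative in the normal direction is a derivative in the normal variable. -/
lemma hasDerivAt_of_hasLineDerivAt_last {f : EuclideanSpace ℝ (Fin (d + 1)) → ℝ} {f' : ℝ}
    {w : EuclideanSpace ℝ (Fin d)} {s : ℝ}
    (h : HasLineDerivAt ℝ f f' (join w s) (stdVec (Fin.last d))) :
    HasDerivAt (fun σ => f (join w σ)) f' s := by
  have h1 : HasDerivAt (fun r => f (join w (s + r))) f' (s - s) := by
    simpa only [HasLineDerivAt, join_add_smul_last, sub_self] using h
  simpa using h1.comp_sub_const s s

/-- A line derivative in a tangential direction is a line derivative in the tangential variable. -/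
lemma hasLineDerivAt_of_castSucc {f : EuclideanSpace ℝ (Fin (d + 1)) → ℝ} {f' : ℝ}
    {w : EuclideanSpace ℝ (Fin d)} {s : ℝ} {j : Fin d}
    (h : HasLineDerivAt ℝ f f' (join w s) (stdVec j.castSucc)) :
    HasLineDerivAt ℝ (fun y => f (join y s)) f' w (stdVec j) := by
  simpa only [HasLineDerivAt, join_add_smul_castSucc] using h

end Coordinates

/-! ### The fundamental solution and its gradient -/

section Newton

variable {d : ℕ}

/-- The constant `1 / ((n - 2) ω_n)`, `n = d + 1`. -/
def newtonConst (d : ℕ) : ℝ := 1 / ((((d + 1 : ℕ) : ℝ) - 2) * sphereArea (d + 1))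

/-- The partial derivative `D_{x_i} E` away from the origin. -/
def gradE (i : Fin (d + 1)) (v : EuclideanSpace ℝ (Fin (d + 1))) : ℝ :=
  newtonConst d * (d - 1) * (v i * ‖v‖ ^ (-(d : ℝ) - 1))

/-- The second derivative `D_{x_i}² E` away from the origin. -/
def hessE (i : Fin (d + 1)) (v : EuclideanSpace ℝ (Fin (d + 1))) : ℝ :=
  newtonConst d * (d - 1) * (‖v‖ ^ (-(d : ℝ) - 1) - (d + 1) * v i ^ 2 * ‖v‖ ^ (-(d : ℝ) - 3))

lemma laplaceFund_eq (v : EuclideanSpace ℝ (Fin (d + 1))) :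
    laplaceFund v = -newtonConst d * ‖v‖ ^ (1 - (d : ℝ)) := by
  rw [laplaceFund, newtonConst, ← Real.rpow_intCast]
  congr 2
  push_cast
  ring

lemma hasDerivAt_norm_sq_line {n : ℕ} (v : EuclideanSpace ℝ (Fin n)) (i : Fin n) :
    HasDerivAt (fun r : ℝ => ‖v + r • stdVec i‖ ^ 2) (2 * v i) 0 := by
  have h2 : ∀ r : ℝ, ‖v + r • stdVec i‖ ^ 2 = ‖v‖ ^ 2 + 2 * v i * r + r ^ 2 := by
    intro r
    rw [norm_add_sq_real, norm_smul, norm_stdVec, inner_smul_right, stdVec,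
      EuclideanSpace.inner_single_right]
    simp
    ring
  simp_rw [h2]
  have := (((hasDerivAt_id (0 : ℝ)).const_mul (2 * v i)).const_add (‖v‖ ^ 2)).fun_add
    ((hasDerivAt_id (0 : ℝ)).fun_pow 2)
  simpa using this

lemma hasLineDerivAt_norm_rpow {n : ℕ} {v : EuclideanSpace ℝ (Fin n)} (hv : v ≠ 0) (p : ℝ)
    (i : Fin n) :
    HasLineDerivAt ℝ (fun v : EuclideanSpace ℝ (Fin n) => ‖v‖ ^ p) (p * v i * ‖v‖ ^ (p - 2)) v
      (stdVec i) := by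
  have h0 := hasDerivAt_norm_sq_line v i
  -- The power is treated as `(‖v‖²)^(p/2)`, because `‖v‖²` is a quadratic polynomial along the
  -- line.
  have h1 := h0.rpow_const (p := p / 2) (Or.inl (by simpa using hv))
  have hrp : ∀ (u : EuclideanSpace ℝ (Fin n)) (q : ℝ), (‖u‖ ^ 2) ^ (q / 2) = ‖u‖ ^ q := by
    intro u q
    rw [← Real.rpow_natCast, ← Real.rpow_mul (norm_nonneg _)]
    congr 1
    push_cast
    ring
  rw [HasLineDerivAt]
  simp_rw [hrp] at h1
  refine h1.congr_deriv ?_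
  rw [show p / 2 - 1 = (p - 2) / 2 by ring, hrp, zero_smul, add_zero]
  ring

lemma hasLineDerivAt_coord {n : ℕ} (v : EuclideanSpace ℝ (Fin n)) (i : Fin n) :
    HasLineDerivAt ℝ (fun v : EuclideanSpace ℝ (Fin n) => v i) 1 v (stdVec i) := by
  have : HasDerivAt (fun r : ℝ => v i + r) 1 0 := (hasDerivAt_id (0 : ℝ)).const_add (v i)
  simpa [HasLineDerivAt, stdVec] using this

lemma hasLineDerivAt_laplaceFund {v : EuclideanSpace ℝ (Fin (d + 1))} (hv : v ≠ 0)
    (i : Fin (d + 1)) : HasLineDerivAt ℝ laplaceFund (gradE i v) v (stdVec i) := by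
  have h := (hasLineDerivAt_norm_rpow hv (1 - (d : ℝ)) i)
  rw [HasLineDerivAt] at h ⊢
  simp_rw [laplaceFund_eq]
  refine (h.const_mul (-newtonConst d)).congr_deriv ?_
  rw [gradE, show 1 - (d : ℝ) - 2 = -(d : ℝ) - 1 by ring]
  ring

lemma hasLineDerivAt_gradE {v : EuclideanSpace ℝ (Fin (d + 1))} (hv : v ≠ 0)
    (i : Fin (d + 1)) : HasLineDerivAt ℝ (gradE i) (hessE i v) v (stdVec i) := by
  have h := hasLineDerivAt_norm_rpow hv (-(d : ℝ) - 1) i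
  have h' := hasLineDerivAt_coord v i
  rw [HasLineDerivAt] at h h' ⊢
  refine ((h'.mul h).const_mul (newtonConst d * (d - 1))).congr_deriv ?_
  rw [hessE, show -(d : ℝ) - 1 - 2 = -(d : ℝ) - 3 by ring, zero_smul, add_zero]
  ring

lemma pderiv_laplaceFund {v : EuclideanSpace ℝ (Fin (d + 1))} (hv : v ≠ 0) (i : Fin (d + 1)) :
    pderiv i laplaceFund v = gradE i v :=
  (hasLineDerivAt_laplaceFund hv i).lineDeriv

/-- Harmonicity of `E`. -/
lemma sum_hessE {v : EuclideanSpace ℝ (Fin (d + 1))} (hv : v ≠ 0) : ∑ i, hessE i v = 0 := by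
  have h1 : ‖v‖ ^ (-(d : ℝ) - 1) = ‖v‖ ^ 2 * ‖v‖ ^ (-(d : ℝ) - 3) := by
    rw [← Real.rpow_natCast, ← Real.rpow_add (norm_pos_iff.2 hv)]
    congr 1
    push_cast
    ring
  simp only [hessE]
  rw [← Finset.mul_sum, Finset.sum_sub_distrib, ← Finset.sum_mul, ← Finset.mul_sum]
  have h2 : ∑ i, v i ^ 2 = ‖v‖ ^ 2 := by simp [EuclideanSpace.norm_sq_eq]
  rw [h2, h1]
  simp
  right
  ring

lemma abs_coord_le {n : ℕ} (v : EuclideanSpace ℝ (Fin n)) (i : Fin n) : |v i| ≤ ‖v‖ := by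
  simpa using PiLp.norm_apply_le v i

lemma mul_norm_rpow {n : ℕ} {v : EuclideanSpace ℝ (Fin n)} (hv : v ≠ 0) (p : ℝ) :
    ‖v‖ * ‖v‖ ^ (p - 1) = ‖v‖ ^ p := by
  rw [Real.rpow_sub_one (norm_ne_zero_iff.2 hv), mul_div_cancel₀ _ (norm_ne_zero_iff.2 hv)]

/-- An upper bound for the constants in the estimates of the derivatives of `E`. -/
def gradConst (d : ℕ) : ℝ := |newtonConst d * (d - 1)|

lemma gradConst_nonneg : 0 ≤ gradConst d := abs_nonneg _

lemma abs_gradE_le {v : EuclideanSpace ℝ (Fin (d + 1))} (hv : v ≠ 0) (i : Fin (d + 1)) :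
    |gradE i v| ≤ gradConst d * ‖v‖ ^ (-(d : ℝ)) := by
  have h : 0 ≤ ‖v‖ ^ (-(d : ℝ) - 1) := by positivity
  rw [gradE, abs_mul, abs_mul (v i), abs_of_nonneg h, ← mul_norm_rpow hv (-(d : ℝ))]
  have := abs_coord_le v i
  unfold gradConst
  gcongr

lemma abs_hessE_le {v : EuclideanSpace ℝ (Fin (d + 1))} (hv : v ≠ 0) (i : Fin (d + 1)) :
    |hessE i v| ≤ gradConst d * ((d + 2) * ‖v‖ ^ (-(d : ℝ) - 1)) := by
  have h : 0 ≤ ‖v‖ ^ (-(d : ℝ) - 3) := by positivity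
  have h1 : ‖v‖ ^ (-(d : ℝ) - 1) = ‖v‖ ^ 2 * ‖v‖ ^ (-(d : ℝ) - 3) := by
    rw [← Real.rpow_natCast, ← Real.rpow_add (norm_pos_iff.2 hv)]
    congr 1
    push_cast
    ring
  rw [hessE, abs_mul, h1]
  refine mul_le_mul_of_nonneg_left ?_ (abs_nonneg _)
  have h2 : v i ^ 2 ≤ ‖v‖ ^ 2 := by
    rw [← sq_abs]
    exact pow_le_pow_left₀ (abs_nonneg _) (abs_coord_le v i) 2
  have h3 : v i ^ 2 * ‖v‖ ^ (-(d : ℝ) - 3) ≤ ‖v‖ ^ 2 * ‖v‖ ^ (-(d : ℝ) - 3) := by gcongr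
  have h4 : 0 ≤ v i ^ 2 * ‖v‖ ^ (-(d : ℝ) - 3) := by positivity
  have hd : (0 : ℝ) ≤ d := Nat.cast_nonneg d
  rw [abs_le]
  constructor <;> nlinarith

/-- For `|u| ≤ |v|` the kernel `v_i |v|^{-d-1}` is Hölder continuous of exponent `1/2` with constant
`|u|^{-d-1/2}`. -/
lemma abs_sub_le_of_norm_le {u v : EuclideanSpace ℝ (Fin (d + 1))} (hu : u ≠ 0)
    (huv : ‖u‖ ≤ ‖v‖) (i : Fin (d + 1)) :
    |u i * ‖u‖ ^ (-(d : ℝ) - 1) - v i * ‖v‖ ^ (-(d : ℝ) - 1)| ≤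
      2 * (d + 2) * (‖u - v‖ ^ (1 / 2 : ℝ) * ‖u‖ ^ (-(d : ℝ) - 1 / 2)) := by
  have hu0 : 0 < ‖u‖ := norm_pos_iff.2 hu
  have hv0 : 0 < ‖v‖ := hu0.trans_le huv
  set A := ‖u‖
  set B := ‖v‖
  set r := ‖u - v‖
  have hr0 : 0 ≤ r := norm_nonneg _
  have hr2 : r ≤ 2 * B := by
    have := norm_sub_le u v
    linarith
  have hBA : B - A ≤ r := by
    have := norm_sub_norm_le v u
    rw [norm_sub_rev] at this
    exact this
  have hA : A * A ^ (-(d : ℝ) - 1) = A ^ (-(d : ℝ)) := by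
    rw [Real.rpow_sub_one hu0.ne', mul_div_cancel₀ _ hu0.ne']
  have hpow : B ^ (-(d : ℝ) - 1) = A ^ (-(d : ℝ) - 1) * (A / B) ^ (d + 1) := by
    rw [show -(d : ℝ) - 1 = -((d + 1 : ℕ) : ℝ) by push_cast; ring, Real.rpow_neg hv0.le,
      Real.rpow_neg hu0.le, Real.rpow_natCast, Real.rpow_natCast, div_pow]
    field_simp
  have hq : 0 < A / B := by positivity
  -- Bernoulli's inequality at `A / B - 1`; it makes `1 - (A/B)^(d+1)` linear in `r / B`.
  have hbern : 1 - (d + 1) * (1 - A / B) ≤ (A / B) ^ (d + 1) := by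
    have := one_add_mul_le_pow (a := A / B - 1) (by linarith) (d + 1)
    rw [add_sub_cancel] at this
    push_cast at this
    linarith
  have hAB : 1 - A / B ≤ r / B := by
    rw [one_sub_div hv0.ne']
    gcongr
  have hle1 : (A / B) ^ (d + 1) ≤ A / B := by
    rw [pow_succ]
    have : (A / B) ^ d ≤ 1 := pow_le_one₀ hq.le ((div_le_one hv0).2 huv)
    nlinarith
  have hui : |u i| ≤ A := abs_coord_le u i
  have huvi : |u i - v i| ≤ r := by simpa using abs_coord_le (u - v) i
  have hA1 : 0 < A ^ (-(d : ℝ) - 1) := by positivity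
  -- Lipschitz bound relative to the larger norm `B`: with `ρ = (A/B)^(d+1)`, the difference equals
  -- `A^(-d-1)` times `u_i (1 - ρ) + (u_i - v_i) ρ`.
  have key : |u i * A ^ (-(d : ℝ) - 1) - v i * B ^ (-(d : ℝ) - 1)| ≤
      (d + 2) * (r / B) * A ^ (-(d : ℝ)) := by
    rw [hpow, show u i * A ^ (-(d : ℝ) - 1) - v i * (A ^ (-(d : ℝ) - 1) * (A / B) ^ (d + 1))
      = A ^ (-(d : ℝ) - 1) * (u i * (1 - (A / B) ^ (d + 1)) + (u i - v i) * (A / B) ^ (d + 1)) by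
        ring, abs_mul, abs_of_pos hA1, ← hA]
    have h1 : |u i * (1 - (A / B) ^ (d + 1)) + (u i - v i) * (A / B) ^ (d + 1)| ≤
        A * ((d + 1) * (r / B)) + r * (A / B) := by
      refine (abs_add_le _ _).trans (add_le_add ?_ ?_)
      · rw [abs_mul, abs_of_nonneg (a := 1 - (A / B) ^ (d + 1))]
        · refine mul_le_mul hui ?_ ?_ hu0.le
          · have : ((d : ℝ) + 1) * (1 - A / B) ≤ (d + 1) * (r / B) := by gcongr
            linarith
          · have := pow_le_one₀ (n := d + 1) hq.le ((div_le_one hv0).2 huv)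
            linarith
        · have := pow_le_one₀ (n := d + 1) hq.le ((div_le_one hv0).2 huv)
          linarith
      · rw [abs_mul, abs_of_nonneg (a := (A / B) ^ (d + 1)) (by positivity)]
        exact mul_le_mul huvi hle1 (by positivity) hr0
    calc A ^ (-(d : ℝ) - 1) * |u i * (1 - (A / B) ^ (d + 1)) + (u i - v i) * (A / B) ^ (d + 1)|
        ≤ A ^ (-(d : ℝ) - 1) * (A * ((d + 1) * (r / B)) + r * (A / B)) := by gcongr
      _ = _ := by ring
  refine key.trans ?_
  -- Interpolation: of the two factors `(r/B)^(1/2)`, one is at most `2` since `r ≤ 2B`, the other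
  -- at most `(r/A)^(1/2)` since `A ≤ B`. This trades the Lipschitz bound for a Hölder one.
  have hrB : r / B ≤ 2 * (r ^ (1 / 2 : ℝ) * A ^ (-1 / 2 : ℝ)) := by
    have e1 : r / B = (r / B) ^ (1 / 2 : ℝ) * (r / B) ^ (1 / 2 : ℝ) := by
      rw [← Real.sqrt_eq_rpow, Real.mul_self_sqrt (by positivity)]
    have e2 : (r / B) ^ (1 / 2 : ℝ) ≤ 2 := by
      have h4 : r / B ≤ 4 := by
        rw [div_le_iff₀ hv0]
        linarith
      calc (r / B) ^ (1 / 2 : ℝ) ≤ (4 : ℝ) ^ (1 / 2 : ℝ) := by gcongr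
        _ = 2 := by
          rw [← Real.sqrt_eq_rpow, show (4 : ℝ) = 2 ^ 2 by norm_num]
          exact Real.sqrt_sq (by norm_num)
    have e3 : (r / B) ^ (1 / 2 : ℝ) ≤ r ^ (1 / 2 : ℝ) * A ^ (-1 / 2 : ℝ) := by
      rw [neg_div, Real.rpow_neg hu0.le, ← div_eq_mul_inv, ← Real.div_rpow hr0 hu0.le]
      gcongr
    rw [e1]
    gcongr
  calc (d + 2) * (r / B) * A ^ (-(d : ℝ))
      ≤ (d + 2) * (2 * (r ^ (1 / 2 : ℝ) * A ^ (-1 / 2 : ℝ))) * A ^ (-(d : ℝ)) := by gcongr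
    _ = 2 * (d + 2) * (r ^ (1 / 2 : ℝ) * (A ^ (-(d : ℝ)) * A ^ (-1 / 2 : ℝ))) := by ring
    _ = _ := by
      rw [← Real.rpow_add hu0]
      congr 4
      ring

/-- Adding both powers removes the ordering of the norms. The exponent `-d - 1/2` is integrable over
the hyperplane `{x_n = s}`, whereas the `-d` of `abs_gradE_le` is not. -/
lemma abs_gradE_sub_le {u v : EuclideanSpace ℝ (Fin (d + 1))} (hu : u ≠ 0) (hv : v ≠ 0)
    (i : Fin (d + 1)) :
    |gradE i u - gradE i v| ≤ gradConst d * (2 * (d + 2)) * ‖u - v‖ ^ (1 / 2 : ℝ) *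
      (‖u‖ ^ (-(d : ℝ) - 1 / 2) + ‖v‖ ^ (-(d : ℝ) - 1 / 2)) := by
  rw [gradE, gradE, ← mul_sub, abs_mul, mul_assoc, mul_assoc]
  refine mul_le_mul_of_nonneg_left ?_ (abs_nonneg _)
  have hu1 : 0 ≤ ‖u‖ ^ (-(d : ℝ) - 1 / 2) := by positivity
  have hv1 : 0 ≤ ‖v‖ ^ (-(d : ℝ) - 1 / 2) := by positivity
  rcases le_total ‖u‖ ‖v‖ with h | h
  · refine (abs_sub_le_of_norm_le hu h i).trans ?_
    gcongr
    linarith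
  · rw [abs_sub_comm, norm_sub_rev]
    refine (abs_sub_le_of_norm_le hv h i).trans ?_
    gcongr
    linarith

lemma measurable_gradE (i : Fin (d + 1)) : Measurable (gradE i) := by
  unfold gradE
  fun_prop

lemma measurable_hessE (i : Fin (d + 1)) : Measurable (hessE i) := by
  unfold hessE
  fun_prop

lemma measurable_laplaceFund : Measurable (laplaceFund (n := d + 1)) := by
  have : laplaceFund (n := d + 1) = fun v => -newtonConst d * ‖v‖ ^ (1 - (d : ℝ)) :=
    funext laplaceFund_eq
  rw [this]
  fun_prop

end Newton

/-! ### Gaussian kernels -/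

section Gaussian

variable {n : ℕ}

lemma heatKernel_of_pos (y : EuclideanSpace ℝ (Fin n)) {t : ℝ} (ht : 0 < t) :
    heatKernel y t = 1 / Real.sqrt (2 * Real.pi * t) ^ n * Real.exp (-‖y‖ ^ 2 / (2 * t)) :=
  if_pos ht

lemma heatKernel_nonneg (y : EuclideanSpace ℝ (Fin n)) (t : ℝ) : 0 ≤ heatKernel y t := by
  unfold heatKernel
  split_ifs <;> positivity

lemma heatKernel_le (y : EuclideanSpace ℝ (Fin n)) {t : ℝ} (ht : 0 < t) :
    heatKernel y t ≤ 1 / Real.sqrt (2 * Real.pi * t) ^ n := by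
  rw [heatKernel_of_pos y ht]
  refine mul_le_of_le_one_right (by positivity) (Real.exp_le_one_iff.2 ?_)
  rw [neg_div]
  have : 0 ≤ ‖y‖ ^ 2 / (2 * t) := by positivity
  linarith

lemma heatKernel_neg (y : EuclideanSpace ℝ (Fin n)) (t : ℝ) :
    heatKernel (-y) t = heatKernel y t := by
  simp [heatKernel]

lemma continuous_heatKernel {t : ℝ} (ht : 0 < t) :
    Continuous fun y : EuclideanSpace ℝ (Fin n) => heatKernel y t := by
  simp_rw [fun y : EuclideanSpace ℝ (Fin n) => heatKernel_of_pos y ht]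
  fun_prop

lemma measurable_heatKernel :
    Measurable fun p : EuclideanSpace ℝ (Fin n) × ℝ => heatKernel p.1 p.2 := by
  unfold heatKernel
  refine Measurable.ite (measurableSet_lt measurable_const measurable_snd) ?_ measurable_const
  fun_prop

lemma integrable_heatKernel {t : ℝ} (ht : 0 < t) :
    Integrable (fun y : EuclideanSpace ℝ (Fin n) => heatKernel y t) := by
  have hb : 0 < 1 / (2 * t) := by positivity
  have h : Integrable (fun y : EuclideanSpace ℝ (Fin n) => Real.exp (-(1 / (2 * t)) * ‖y‖ ^ 2)) := by
    refine Integrable.of_integral_ne_zero ?_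
    rw [GaussianFourier.integral_rexp_neg_mul_sq_norm hb]
    positivity
  simp_rw [fun y : EuclideanSpace ℝ (Fin n) => heatKernel_of_pos y ht]
  refine Integrable.const_mul ?_ _
  refine h.congr (Eventually.of_forall fun y => ?_)
  simp only
  congr 1
  ring

lemma integral_heatKernel {t : ℝ} (ht : 0 < t) :
    ∫ y : EuclideanSpace ℝ (Fin n), heatKernel y t = 1 := by
  have hb : 0 < 1 / (2 * t) := by positivity
  have h := GaussianFourier.integral_rexp_neg_mul_sq_norm (V := EuclideanSpace ℝ (Fin n)) hb
  simp_rw [fun y : EuclideanSpace ℝ (Fin n) => heatKernel_of_pos y ht]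
  rw [integral_const_mul]
  have h2 : ∀ y : EuclideanSpace ℝ (Fin n), -‖y‖ ^ 2 / (2 * t) = -(1 / (2 * t)) * ‖y‖ ^ 2 := by
    intro y; ring
  simp_rw [h2]
  rw [h, finrank_euclideanSpace_fin, show Real.pi / (1 / (2 * t)) = 2 * Real.pi * t by field_simp,
    Real.sqrt_eq_rpow, ← Real.rpow_natCast, ← Real.rpow_mul (by positivity), one_div_mul_eq_div,
    one_div_mul_eq_div, div_self]
  positivity

/-- The partial derivative `D_{y_j} Γ(y,t)`. -/
def gradHeat (j : Fin n) (y : EuclideanSpace ℝ (Fin n)) (t : ℝ) : ℝ :=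
  -(y j / t) * heatKernel y t

lemma gradHeat_neg (j : Fin n) (y : EuclideanSpace ℝ (Fin n)) (t : ℝ) :
    gradHeat j (-y) t = -gradHeat j y t := by
  simp only [gradHeat, heatKernel_neg, PiLp.neg_apply]
  ring

lemma hasLineDerivAt_heatKernel (y : EuclideanSpace ℝ (Fin n)) {t : ℝ} (ht : 0 < t) (j : Fin n) :
    HasLineDerivAt ℝ (fun y => heatKernel y t) (gradHeat j y t) y (stdVec j) := by
  have h0 := hasDerivAt_norm_sq_line y j
  rw [HasLineDerivAt]
  simp_rw [fun y : EuclideanSpace ℝ (Fin n) => heatKernel_of_pos y ht]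
  refine (((h0.fun_neg.div_const (2 * t)).exp).const_mul _).congr_deriv ?_
  rw [gradHeat, heatKernel_of_pos y ht, zero_smul, add_zero]
  field_simp

lemma continuous_gradHeat (j : Fin n) {t : ℝ} (ht : 0 < t) :
    Continuous fun y : EuclideanSpace ℝ (Fin n) => gradHeat j y t := by
  have := continuous_heatKernel (n := n) ht
  unfold gradHeat
  fun_prop

lemma measurable_gradHeat (j : Fin n) :
    Measurable fun p : EuclideanSpace ℝ (Fin n) × ℝ => gradHeat j p.1 p.2 := by
  have := measurable_heatKernel (n := n)
  unfold gradHeat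
  fun_prop

lemma one_add_mul_exp_le (q : ℝ) : (1 + q) * Real.exp (-q / 2) ≤ 4 * Real.exp (-q / 4) := by
  have h1 : 1 + q ≤ 4 * Real.exp (q / 4) := by
    have := Real.add_one_le_exp (q / 4)
    linarith
  calc (1 + q) * Real.exp (-q / 2) ≤ 4 * Real.exp (q / 4) * Real.exp (-q / 2) := by gcongr
    _ = 4 * Real.exp (-q / 4) := by
      rw [mul_assoc, ← Real.exp_add]
      congr 2
      ring

lemma rpow_le_one_add {q β : ℝ} (hq : 0 ≤ q) (h0 : 0 ≤ β) (h1 : β ≤ 1) : q ^ β ≤ 1 + q := by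
  rcases le_total q 1 with h | h
  · have := Real.rpow_le_one hq h h0
    linarith
  · have := Real.rpow_le_rpow_of_exponent_le h h1
    rw [Real.rpow_one] at this
    linarith

/-- Half of the Gaussian exponent absorbs the power, at the price of doubling the time; `√2 ^ n` is
the ratio of the two normalisations. -/
lemma rpow_mul_heatKernel_le (y : EuclideanSpace ℝ (Fin n)) {t β : ℝ} (ht : 0 < t) (h0 : 0 ≤ β)
    (h1 : β ≤ 1) :
    (‖y‖ ^ 2 / t) ^ β * heatKernel y t ≤ 4 * Real.sqrt 2 ^ n * heatKernel y (2 * t) := by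
  set q := ‖y‖ ^ 2 / t with hq
  have hq0 : 0 ≤ q := by positivity
  rw [heatKernel_of_pos y ht, heatKernel_of_pos y (by positivity : 0 < 2 * t)]
  have e1 : -‖y‖ ^ 2 / (2 * t) = -q / 2 := by rw [hq]; field_simp
  have e2 : -‖y‖ ^ 2 / (2 * (2 * t)) = -q / 4 := by rw [hq]; field_simp; norm_num
  have e3 : Real.sqrt (2 * Real.pi * (2 * t)) = Real.sqrt 2 * Real.sqrt (2 * Real.pi * t) := by
    rw [← Real.sqrt_mul (by norm_num)]
    congr 1
    ring
  have hs : 0 < Real.sqrt (2 * Real.pi * t) := by positivity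
  have hs2 : 0 < Real.sqrt 2 := by positivity
  rw [e1, e2, e3, mul_pow]
  have hk : q ^ β * Real.exp (-q / 2) ≤ 4 * Real.exp (-q / 4) :=
    (mul_le_mul_of_nonneg_right (rpow_le_one_add hq0 h0 h1) (Real.exp_pos _).le).trans
      (one_add_mul_exp_le q)
  calc q ^ β * (1 / Real.sqrt (2 * Real.pi * t) ^ n * Real.exp (-q / 2))
      = 1 / Real.sqrt (2 * Real.pi * t) ^ n * (q ^ β * Real.exp (-q / 2)) := by ring
    _ ≤ 1 / Real.sqrt (2 * Real.pi * t) ^ n * (4 * Real.exp (-q / 4)) := by gcongr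
    _ = _ := by field_simp

/-- The gradient of the Gaussian kernel, with a Hölder weight of exponent `2 β - 1`. -/
lemma abs_gradHeat_mul_rpow_le (j : Fin n) (y : EuclideanSpace ℝ (Fin n)) {t α : ℝ} (ht : 0 < t)
    (h0 : 0 ≤ α) (h1 : α ≤ 1) :
    |gradHeat j y t| * ‖y‖ ^ α ≤
      t ^ (-(1 - α) / 2) * (4 * Real.sqrt 2 ^ n * heatKernel y (2 * t)) := by
  -- The gradient contributes one factor `‖y‖` and the weight a factor `‖y‖^α`; the exponent `(1 +
  -- α)/2` of `‖y‖²/t` collects both and leaves `t^(-(1-α)/2)`.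
  have h := rpow_mul_heatKernel_le y ht (β := (1 + α) / 2) (by linarith) (by linarith)
  have hk := heatKernel_nonneg y t
  have e : t ^ (-(1 - α) / 2) * (‖y‖ ^ 2 / t) ^ ((1 + α) / 2) = ‖y‖ * ‖y‖ ^ α / t := by
    rw [Real.div_rpow (by positivity) ht.le, ← Real.rpow_natCast ‖y‖ 2,
      ← Real.rpow_mul (norm_nonneg _), mul_div_assoc', mul_comm, mul_div_assoc,
      ← Real.rpow_sub ht]
    rw [show -(1 - α) / 2 - (1 + α) / 2 = -1 by ring, Real.rpow_neg_one, ← div_eq_mul_inv]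
    congr 1
    rcases (norm_nonneg y).eq_or_lt with hy | hy
    · rw [← hy, zero_mul, Real.zero_rpow]
      push_cast
      linarith
    · nth_rewrite 2 [← Real.rpow_one ‖y‖]
      rw [← Real.rpow_add hy]
      congr 1
      push_cast
      ring
  calc |gradHeat j y t| * ‖y‖ ^ α = |y j| / t * heatKernel y t * ‖y‖ ^ α := by
        rw [gradHeat, abs_mul, abs_neg, abs_div, abs_of_pos ht, abs_of_nonneg hk]
    _ ≤ ‖y‖ / t * heatKernel y t * ‖y‖ ^ α := by
        have := abs_coord_le y j
        gcongr
    _ = (‖y‖ * ‖y‖ ^ α / t) * heatKernel y t := by ring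
    _ = t ^ (-(1 - α) / 2) * ((‖y‖ ^ 2 / t) ^ ((1 + α) / 2) * heatKernel y t) := by
        rw [← e]; ring
    _ ≤ _ := by gcongr

lemma abs_gradHeat_le (j : Fin n) (y : EuclideanSpace ℝ (Fin n)) {t : ℝ} (ht : 0 < t) :
    |gradHeat j y t| ≤ t ^ (-1 / 2 : ℝ) * (4 * Real.sqrt 2 ^ n) * heatKernel y (2 * t) := by
  have := abs_gradHeat_mul_rpow_le j y ht le_rfl zero_le_one
  simpa [mul_assoc] using this

lemma integrable_gradHeat (j : Fin n) {t : ℝ} (ht : 0 < t) :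
    Integrable (fun y : EuclideanSpace ℝ (Fin n) => gradHeat j y t) := by
  refine ((integrable_heatKernel (n := n) (by positivity : 0 < 2 * t)).const_mul
    (t ^ (-1 / 2 : ℝ) * (4 * Real.sqrt 2 ^ n))).mono'
    (continuous_gradHeat j ht).aestronglyMeasurable (Eventually.of_forall fun y => ?_)
  exact abs_gradHeat_le j y ht

/-- The kernel is odd. This cancellation is what `gradConv'_eq` exploits. -/
lemma integral_gradHeat (j : Fin n) (t : ℝ) :
    ∫ y : EuclideanSpace ℝ (Fin n), gradHeat j y t = 0 := by
  have h := integral_neg_eq_self (fun y : EuclideanSpace ℝ (Fin n) => gradHeat j y t) volume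
  simp_rw [gradHeat_neg, integral_neg] at h
  linarith

/-- A Gaussian translated by a unit vector is dominated by a wider Gaussian. -/
lemma heatKernel_add_le (u e : EuclideanSpace ℝ (Fin n)) (he : ‖e‖ ≤ 1) {t : ℝ} (ht : 0 < t) :
    heatKernel (u + e) t ≤ Real.exp (1 / (2 * t)) * Real.sqrt 2 ^ n * heatKernel u (2 * t) := by
  rw [heatKernel_of_pos _ ht, heatKernel_of_pos u (by positivity : 0 < 2 * t)]
  have e3 : Real.sqrt (2 * Real.pi * (2 * t)) = Real.sqrt 2 * Real.sqrt (2 * Real.pi * t) := by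
    rw [← Real.sqrt_mul (by norm_num)]
    congr 1
    ring
  have hs : 0 < Real.sqrt (2 * Real.pi * t) := by positivity
  have hs2 : 0 < Real.sqrt 2 := by positivity
  have hu : ‖u‖ ^ 2 ≤ 2 * ‖u + e‖ ^ 2 + 2 := by
    have h1 : ‖u‖ ≤ ‖u + e‖ + 1 := by
      have := norm_sub_le (u + e) e
      rw [add_sub_cancel_right] at this
      linarith
    have h2 := norm_nonneg u
    nlinarith [sq_nonneg (‖u + e‖ - 1), norm_nonneg (u + e)]
  have hexp : Real.exp (-‖u + e‖ ^ 2 / (2 * t)) ≤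
      Real.exp (1 / (2 * t)) * Real.exp (-‖u‖ ^ 2 / (2 * (2 * t))) := by
    rw [← Real.exp_add]
    refine Real.exp_le_exp.2 ?_
    rw [show 1 / (2 * t) + -‖u‖ ^ 2 / (2 * (2 * t)) = (1 - ‖u‖ ^ 2 / 2) / (2 * t) by
      field_simp; ring]
    gcongr
    linarith
  rw [e3, mul_pow]
  calc 1 / Real.sqrt (2 * Real.pi * t) ^ n * Real.exp (-‖u + e‖ ^ 2 / (2 * t))
      ≤ 1 / Real.sqrt (2 * Real.pi * t) ^ n *
        (Real.exp (1 / (2 * t)) * Real.exp (-‖u‖ ^ 2 / (2 * (2 * t)))) := by gcongr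
    _ = _ := by field_simp

/-- The one-dimensional Gaussian kernel. -/
def gaussN (z t : ℝ) : ℝ := 1 / Real.sqrt (2 * Real.pi * t) * Real.exp (-z ^ 2 / (2 * t))

/-- The derivative of `gaussN` in the space variable. -/
def gaussN' (z t : ℝ) : ℝ := -(z / t) * gaussN z t

/-- The second derivative of `gaussN` in the space variable. -/
def gaussN'' (z t : ℝ) : ℝ := (z ^ 2 / t ^ 2 - 1 / t) * gaussN z t

lemma heatKernel_join (w : EuclideanSpace ℝ (Fin n)) (z : ℝ) {t : ℝ} (ht : 0 < t) :
    heatKernel (join w z) t = gaussN z t * heatKernel w t := by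
  rw [heatKernel_of_pos _ ht, heatKernel_of_pos _ ht, norm_join_sq, gaussN, neg_add, add_div,
    Real.exp_add, pow_succ]
  field_simp

lemma hasDerivAt_gaussN (z t : ℝ) : HasDerivAt (fun z => gaussN z t) (gaussN' z t) z := by
  unfold gaussN' gaussN
  refine (((((hasDerivAt_id z).fun_pow 2).fun_neg.div_const (2 * t)).exp).const_mul
    (1 / Real.sqrt (2 * Real.pi * t))).congr_deriv ?_
  simp only [id]
  push_cast
  field_simp

lemma hasDerivAt_gaussN' (z t : ℝ) : HasDerivAt (fun z => gaussN' z t) (gaussN'' z t) z := by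
  refine ((((hasDerivAt_id z).div_const t).fun_neg).fun_mul (hasDerivAt_gaussN z t)).congr_deriv ?_
  unfold gaussN'' gaussN'
  simp only [id]
  ring

/-- The Gaussian factorises, so the normal derivative acts on the one-dimensional factor only. -/
lemma pderiv_heatKernel_join (w : EuclideanSpace ℝ (Fin n)) (z : ℝ) {t : ℝ} (ht : 0 < t) :
    pderiv (Fin.last n) (fun y => heatKernel y t) (join w z) = gaussN' z t * heatKernel w t := by
  have h := hasLineDerivAt_heatKernel (join w z) ht (Fin.last n)
  rw [pderiv, h.lineDeriv, gradHeat, join_last, heatKernel_join w z ht, gaussN']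
  ring

lemma gaussN_nonneg (z t : ℝ) : 0 ≤ gaussN z t := by unfold gaussN; positivity

lemma gaussN'_zero (t : ℝ) : gaussN' 0 t = 0 := by simp [gaussN']

lemma continuous_gaussN' (t : ℝ) : Continuous fun z => gaussN' z t := by
  unfold gaussN' gaussN; fun_prop

lemma continuous_gaussN'' (t : ℝ) : Continuous fun z => gaussN'' z t := by
  unfold gaussN'' gaussN; fun_prop

lemma measurable_gaussN' : Measurable fun p : ℝ × ℝ => gaussN' p.1 p.2 := by
  unfold gaussN' gaussN; fun_prop

end Gaussian

/-! ### Integrals of powers -/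

section Powers

variable {d : ℕ}

/-- The constant `∫ (|u|² + 1)^{-(d + 1/2)/2} du`. -/
def profileConst (d : ℕ) : ℝ :=
  ∫ u : EuclideanSpace ℝ (Fin d), ‖join u 1‖ ^ (-(d : ℝ) - 1 / 2)

lemma norm_join_smul (u : EuclideanSpace ℝ (Fin d)) {s : ℝ} (hs : 0 ≤ s) :
    ‖join (s • u) s‖ = s * ‖join u 1‖ := by
  refine (pow_left_inj₀ (norm_nonneg _) (by positivity) two_ne_zero).1 ?_
  rw [norm_join_sq, mul_pow, norm_join_sq, norm_smul, Real.norm_of_nonneg hs]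
  ring

lemma integrable_norm_join_one {r : ℝ} (hr : (d : ℝ) < r) :
    Integrable (fun u : EuclideanSpace ℝ (Fin d) => ‖join u 1‖ ^ (-r)) := by
  refine (integrable_rpow_neg_one_add_norm_sq (r := r) (by simpa using hr)).congr
    (Eventually.of_forall fun u => ?_)
  simp only
  rw [show (1 : ℝ) + ‖u‖ ^ 2 = ‖join u 1‖ ^ 2 by rw [norm_join_sq]; ring, ← Real.rpow_natCast,
    ← Real.rpow_mul (norm_nonneg _)]
  congr 1
  push_cast
  ring

lemma integrable_profile {s : ℝ} (hs : 0 < s) :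
    Integrable (fun w : EuclideanSpace ℝ (Fin d) => ‖join w s‖ ^ (-(d : ℝ) - 1 / 2)) := by
  rw [← integrable_comp_smul_iff volume _ hs.ne']
  simp_rw [norm_join_smul _ hs.le]
  have h := (integrable_norm_join_one (d := d) (r := d + 1 / 2) (by linarith)).const_mul
    (s ^ (-(d : ℝ) - 1 / 2))
  refine h.congr (Eventually.of_forall fun u => ?_)
  simp only
  rw [Real.mul_rpow hs.le (norm_nonneg _), neg_add']

/-- Scaling `w = s u` contributes `s^d · s^(-d-1/2)`. -/
lemma integral_profile {s : ℝ} (hs : 0 < s) :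
    ∫ w : EuclideanSpace ℝ (Fin d), ‖join w s‖ ^ (-(d : ℝ) - 1 / 2) =
      profileConst d * s ^ (-1 / 2 : ℝ) := by
  have h := Measure.integral_comp_smul_of_nonneg (volume : Measure (EuclideanSpace ℝ (Fin d)))
    (fun w => ‖join w s‖ ^ (-(d : ℝ) - 1 / 2)) s (hR := hs.le)
  simp_rw [norm_join_smul _ hs.le, Real.mul_rpow hs.le (norm_nonneg _)] at h
  rw [integral_const_mul, finrank_euclideanSpace_fin, smul_eq_mul, ← profileConst] at h
  have h2 : ∫ w : EuclideanSpace ℝ (Fin d), ‖join w s‖ ^ (-(d : ℝ) - 1 / 2) =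
      s ^ d * (s ^ (-(d : ℝ) - 1 / 2) * profileConst d) := by
    rw [h]
    field_simp
  rw [h2, ← mul_assoc, ← Real.rpow_natCast, ← Real.rpow_add hs, mul_comm]
  congr 2
  ring

lemma profileConst_nonneg : 0 ≤ profileConst d :=
  integral_nonneg fun _ => by positivity

/-- The decay `‖v‖^(-d)` just fails to be integrable at infinity on the hyperplane. The constant
covers `‖v‖ ≥ 1`, the integrable profile covers `‖v‖ ≤ 1`. -/
lemma abs_gradE_join_le (i : Fin (d + 1)) (w : EuclideanSpace ℝ (Fin d)) {s : ℝ} (hs : 0 < s) :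
    |gradE i (join w s)| ≤
      gradConst d + gradConst d * ‖join w s‖ ^ (-(d : ℝ) - 1 / 2) := by
  have h0 := norm_join_pos w hs
  refine (abs_gradE_le (norm_pos_iff.1 h0) i).trans ?_
  have hp : 0 ≤ ‖join w s‖ ^ (-(d : ℝ) - 1 / 2) := by positivity
  have hd : (0 : ℝ) ≤ d := Nat.cast_nonneg d
  rw [show gradConst d + gradConst d * ‖join w s‖ ^ (-(d : ℝ) - 1 / 2) =
    gradConst d * (1 + ‖join w s‖ ^ (-(d : ℝ) - 1 / 2)) by ring]
  refine mul_le_mul_of_nonneg_left ?_ gradConst_nonneg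
  rcases le_total ‖join w s‖ 1 with h | h
  · have := Real.rpow_le_rpow_of_exponent_ge h0 h (show -(d : ℝ) - 1 / 2 ≤ -(d : ℝ) by linarith)
    linarith
  · have := Real.rpow_le_one_of_one_le_of_nonpos h (show -(d : ℝ) ≤ 0 by linarith)
    linarith

/-- The singular part of the fundamental solution on the boundary hyperplane. -/
def boundaryProfile (w : EuclideanSpace ℝ (Fin d)) : ℝ :=
  (Metric.ball 0 1).indicator (fun w => ‖w‖ ^ (1 - (d : ℝ))) w

lemma integrable_boundaryProfile (hd : 1 ≤ d) :
    Integrable (boundaryProfile (d := d)) := by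
  refine IntegrableOn.integrable_indicator ?_ measurableSet_ball
  refine integrableOn_ball_of_norm_le_rpow (C := 1) (α := (d : ℝ) - 1) (by simpa using hd)
    (by simp) (Eventually.of_forall fun w => ?_)
    (Measurable.aestronglyMeasurable (by fun_prop))
  rw [one_mul, Real.norm_of_nonneg (by positivity), neg_sub]

/-- The bound is uniform in `s`, because `‖(w, s)‖ ≥ ‖w‖` and the exponent is nonpositive; it
therefore serves as dominating function for `s → 0`. -/
lemma abs_laplaceFund_join_le (hd : 1 ≤ d) {w : EuclideanSpace ℝ (Fin d)} (hw : w ≠ 0) (s : ℝ) :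
    |laplaceFund (join w s)| ≤
      |newtonConst d| + |newtonConst d| * boundaryProfile w := by
  have h0 := norm_pos_iff.2 hw
  have h1 := norm_le_norm_join w s
  have hd' : (1 : ℝ) ≤ d := by exact_mod_cast hd
  rw [laplaceFund_eq, abs_mul, abs_neg, abs_of_nonneg (a := ‖join w s‖ ^ (1 - (d : ℝ))) (by positivity),
    show |newtonConst d| + |newtonConst d| * boundaryProfile w =
      |newtonConst d| * (1 + boundaryProfile w) by ring]
  refine mul_le_mul_of_nonneg_left ?_ (abs_nonneg _)
  refine (Real.rpow_le_rpow_of_nonpos h0 h1 (by linarith)).trans ?_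
  by_cases h : w ∈ Metric.ball (0 : EuclideanSpace ℝ (Fin d)) 1
  · rw [boundaryProfile, indicator_of_mem h]
    linarith
  · rw [boundaryProfile, indicator_of_notMem h]
    rw [mem_ball_zero_iff, not_lt] at h
    have := Real.rpow_le_one_of_one_le_of_nonpos h (show 1 - (d : ℝ) ≤ 0 by linarith)
    linarith

lemma exp_neg_le_inv {q : ℝ} (hq : 0 < q) : Real.exp (-q) ≤ 1 / q := by
  rw [Real.exp_neg, ← one_div]
  have := Real.add_one_le_exp q
  exact one_div_le_one_div_of_le hq (by linarith)

/-- Split at `t = z²`. Below, `e^(-q) ≤ 1/q` gains a factor `t`, and `1 - p > -1`; above, the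
exponential is at most `1`, and `p > 1` gives convergence at infinity. -/
lemma lintegral_rpow_mul_exp_le {p z : ℝ} (hp : 1 < p) (hp2 : p < 2) (hz : 0 < z) :
    ∫⁻ t in Ioi (0 : ℝ), ENNReal.ofReal (t ^ (-p) * Real.exp (-z ^ 2 / (2 * t))) ≤
      ENNReal.ofReal ((2 / (2 - p) + 1 / (p - 1)) * z ^ (2 - 2 * p)) := by
  have hz2 : 0 < z ^ 2 := by positivity
  have hsplit : Ioi (0 : ℝ) = Ioc 0 (z ^ 2) ∪ Ioi (z ^ 2) := (Ioc_union_Ioi_eq_Ioi hz2.le).symm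
  have hzz : ∀ r : ℝ, (z ^ 2) ^ r = z ^ (2 * r) := fun r => by
    rw [← Real.rpow_natCast, ← Real.rpow_mul hz.le]; norm_num
  rw [hsplit]
  refine (lintegral_union_le _ _ _).trans ?_
  rw [add_mul, ENNReal.ofReal_add]
  rotate_left
  · have : 0 < 2 - p := by linarith
    positivity
  · have : 0 < p - 1 := by linarith
    positivity
  refine add_le_add ?_ ?_
  · have hI : IntegrableOn (fun t : ℝ => 2 / z ^ 2 * t ^ (1 - p)) (Ioc 0 (z ^ 2)) := by
      refine Integrable.const_mul ?_ _
      have := intervalIntegral.intervalIntegrable_rpow' (a := 0) (b := z ^ 2) (r := 1 - p)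
        (by linarith)
      rwa [intervalIntegrable_iff_integrableOn_Ioc_of_le hz2.le] at this
    calc ∫⁻ t in Ioc 0 (z ^ 2), ENNReal.ofReal (t ^ (-p) * Real.exp (-z ^ 2 / (2 * t)))
        ≤ ∫⁻ t in Ioc 0 (z ^ 2), ENNReal.ofReal (2 / z ^ 2 * t ^ (1 - p)) := by
          refine setLIntegral_mono' measurableSet_Ioc fun t ht => ENNReal.ofReal_le_ofReal ?_
          have ht0 : 0 < t := ht.1
          have h1 := exp_neg_le_inv (q := z ^ 2 / (2 * t)) (by positivity)
          rw [show 1 - p = -p + 1 by ring, Real.rpow_add_one ht0.ne', neg_div]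
          calc t ^ (-p) * Real.exp (-(z ^ 2 / (2 * t)))
              ≤ t ^ (-p) * (1 / (z ^ 2 / (2 * t))) := by gcongr
            _ = _ := by field_simp
      _ = ENNReal.ofReal (∫ t in Ioc 0 (z ^ 2), 2 / z ^ 2 * t ^ (1 - p)) := by
          refine (ofReal_integral_eq_lintegral_ofReal hI ?_).symm
          filter_upwards [ae_restrict_mem measurableSet_Ioc] with t ht
          have ht0 : 0 < t := ht.1
          positivity
      _ = _ := by
          congr 1
          rw [integral_const_mul, ← intervalIntegral.integral_of_le hz2.le,
            integral_rpow (Or.inl (by linarith)), Real.zero_rpow (by linarith), sub_zero, hzz,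
            show 1 - p + 1 = 2 - p by ring,
            show 2 - 2 * p = 2 * (2 - p) - (2 : ℕ) by push_cast; ring, Real.rpow_sub hz,
            Real.rpow_natCast]
          field_simp
  · have hI : IntegrableOn (fun t : ℝ => t ^ (-p)) (Ioi (z ^ 2)) :=
      integrableOn_Ioi_rpow_of_lt (by linarith) hz2
    calc ∫⁻ t in Ioi (z ^ 2), ENNReal.ofReal (t ^ (-p) * Real.exp (-z ^ 2 / (2 * t)))
        ≤ ∫⁻ t in Ioi (z ^ 2), ENNReal.ofReal (t ^ (-p)) := by
          refine setLIntegral_mono' measurableSet_Ioi fun t ht => ENNReal.ofReal_le_ofReal ?_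
          have ht0 : 0 < t := hz2.trans ht
          refine mul_le_of_le_one_right (by positivity) (Real.exp_le_one_iff.2 ?_)
          rw [neg_div]
          have : 0 ≤ z ^ 2 / (2 * t) := by positivity
          linarith
      _ = ENNReal.ofReal (∫ t in Ioi (z ^ 2), t ^ (-p)) := by
          refine (ofReal_integral_eq_lintegral_ofReal hI ?_).symm
          filter_upwards [ae_restrict_mem measurableSet_Ioi] with t ht
          have ht0 : 0 < t := hz2.trans ht
          positivity
      _ = _ := by
          congr 1
          rw [integral_Ioi_rpow_of_lt (by linarith) hz2, hzz,
            show 2 * (-p + 1) = 2 - 2 * p by ring,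
            show -p + 1 = -(p - 1) by ring, neg_div_neg_eq, one_div_mul_eq_div]

lemma intervalIntegrable_rpow_neg_half (X : ℝ) :
    IntervalIntegrable (fun s : ℝ => s ^ (-1 / 2 : ℝ)) volume 0 X :=
  intervalIntegral.intervalIntegrable_rpow' (by norm_num)

lemma integral_rpow_neg_half (X : ℝ) :
    ∫ s in (0 : ℝ)..X, s ^ (-1 / 2 : ℝ) = 2 * X ^ (1 / 2 : ℝ) := by
  rw [integral_rpow (Or.inl (by norm_num)), Real.zero_rpow (by norm_num),
    show (-1 / 2 + 1 : ℝ) = 1 / 2 by norm_num, sub_zero]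
  ring

/-- The integral is invariant under scaling of `X`, which is why the final constant does not depend
on `x_n`. The larger of `s` and `X - s` is at least `X/2`, so its factor can be frozen at `X/2`. -/
lemma lintegral_beta_le {X : ℝ} (hX : 0 < X) :
    ∫⁻ s in Ioc 0 X, ENNReal.ofReal ((X - s) ^ (-1 / 2 : ℝ) * s ^ (-1 / 2 : ℝ)) ≤
      ENNReal.ofReal 8 := by
  have h1 : IntervalIntegrable (fun s : ℝ => (X - s) ^ (-1 / 2 : ℝ)) volume 0 X := by
    have := (intervalIntegrable_rpow_neg_half X).comp_sub_left X
    simpa using this.symm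
  have h2 := intervalIntegrable_rpow_neg_half X
  have h3 := (h1.add h2).const_mul ((X / 2) ^ (-1 / 2 : ℝ))
  have hi1 : ∫ s in (0 : ℝ)..X, (X - s) ^ (-1 / 2 : ℝ) = 2 * X ^ (1 / 2 : ℝ) := by
    rw [intervalIntegral.integral_comp_sub_left (fun s => s ^ (-1 / 2 : ℝ)) X, sub_self, sub_zero,
      integral_rpow_neg_half]
  calc ∫⁻ s in Ioc 0 X, ENNReal.ofReal ((X - s) ^ (-1 / 2 : ℝ) * s ^ (-1 / 2 : ℝ))
      ≤ ∫⁻ s in Ioc 0 X, ENNReal.ofReal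
          ((X / 2) ^ (-1 / 2 : ℝ) * ((X - s) ^ (-1 / 2 : ℝ) + s ^ (-1 / 2 : ℝ))) := by
        refine setLIntegral_mono' measurableSet_Ioc fun s hs => ENNReal.ofReal_le_ofReal ?_
        have hs0 : 0 < s := hs.1
        have hs1 : 0 ≤ X - s := sub_nonneg.2 hs.2
        rw [mul_add]
        rcases le_total s (X / 2) with h | h
        · have : (X - s) ^ (-1 / 2 : ℝ) ≤ (X / 2) ^ (-1 / 2 : ℝ) :=
            Real.rpow_le_rpow_of_nonpos (by positivity) (by linarith) (by norm_num)
          have h5 : 0 ≤ (X / 2) ^ (-1 / 2 : ℝ) * (X - s) ^ (-1 / 2 : ℝ) := by positivity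
          have h6 : (X - s) ^ (-1 / 2 : ℝ) * s ^ (-1 / 2 : ℝ) ≤
            (X / 2) ^ (-1 / 2 : ℝ) * s ^ (-1 / 2 : ℝ) := by gcongr
          linarith
        · have : s ^ (-1 / 2 : ℝ) ≤ (X / 2) ^ (-1 / 2 : ℝ) :=
            Real.rpow_le_rpow_of_nonpos (by positivity) h (by norm_num)
          have h5 : 0 ≤ (X / 2) ^ (-1 / 2 : ℝ) * s ^ (-1 / 2 : ℝ) := by positivity
          have h6 : (X - s) ^ (-1 / 2 : ℝ) * s ^ (-1 / 2 : ℝ) ≤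
            (X - s) ^ (-1 / 2 : ℝ) * (X / 2) ^ (-1 / 2 : ℝ) := by gcongr
          linarith
    _ = ENNReal.ofReal (∫ s in Ioc 0 X,
          (X / 2) ^ (-1 / 2 : ℝ) * ((X - s) ^ (-1 / 2 : ℝ) + s ^ (-1 / 2 : ℝ))) := by
        refine (ofReal_integral_eq_lintegral_ofReal
          ((intervalIntegrable_iff_integrableOn_Ioc_of_le hX.le).1 h3) ?_).symm
        filter_upwards [ae_restrict_mem measurableSet_Ioc] with s hs
        have hs0 : 0 < s := hs.1
        have hs1 : 0 ≤ X - s := sub_nonneg.2 hs.2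
        positivity
    _ = ENNReal.ofReal (4 * (X / 2) ^ (-1 / 2 : ℝ) * X ^ (1 / 2 : ℝ)) := by
        rw [← intervalIntegral.integral_of_le hX.le, intervalIntegral.integral_const_mul,
          intervalIntegral.integral_add h1 h2, hi1, integral_rpow_neg_half]
        congr 1
        ring
    _ ≤ _ := by
        refine ENNReal.ofReal_le_ofReal ?_
        have e : (X / 2) ^ (-1 / 2 : ℝ) * X ^ (1 / 2 : ℝ) = Real.sqrt 2 := by
          rw [neg_div, Real.rpow_neg (by positivity), ← div_eq_inv_mul,
            ← Real.div_rpow hX.le (by positivity), Real.sqrt_eq_rpow]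
          congr 1
          field_simp
        have h2 : Real.sqrt 2 ≤ 2 := Real.sqrt_le_iff.2 ⟨by norm_num, by norm_num⟩
        rw [mul_assoc, e]
        linarith

end Powers

/-! ### Convolution with Gaussian kernels -/

section Convolution

variable {n : ℕ}

/-- The kernel `k` is measurable and dominated by `c Γ(·, τ)`. -/
structure GaussBound (k : EuclideanSpace ℝ (Fin n) → ℝ) (c τ : ℝ) : Prop where
  meas : Measurable k
  nonneg : 0 ≤ c
  pos : 0 < τ
  le : ∀ u, |k u| ≤ c * heatKernel u τ

/-- The function `f` is measurable and dominated by a constant plus an integrable function. -/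
structure Tame (f : EuclideanSpace ℝ (Fin n) → ℝ) (A : ℝ) (g : EuclideanSpace ℝ (Fin n) → ℝ) :
    Prop where
  meas : AEStronglyMeasurable f
  nonneg : 0 ≤ A
  g_nonneg : ∀ w, 0 ≤ g w
  integrable : Integrable g
  le : ∀ᵐ w, |f w| ≤ A + g w

lemma Tame.of_bounded {f : EuclideanSpace ℝ (Fin n) → ℝ} {A : ℝ} (hf : Measurable f)
    (h : ∀ w, |f w| ≤ A) : Tame f A 0 where
  meas := hf.aestronglyMeasurable
  nonneg := (abs_nonneg _).trans (h 0)
  g_nonneg _ := le_rfl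
  integrable := integrable_zero _ _ _
  le := Eventually.of_forall fun w => by simpa using h w

lemma gaussBound_heatKernel {t : ℝ} (ht : 0 < t) :
    GaussBound (fun u : EuclideanSpace ℝ (Fin n) => heatKernel u t) 1 t where
  meas := (continuous_heatKernel ht).measurable
  nonneg := zero_le_one
  pos := ht
  le u := by rw [abs_of_nonneg (heatKernel_nonneg u t), one_mul]

lemma gaussBound_gradHeat (j : Fin n) {t : ℝ} (ht : 0 < t) :
    GaussBound (fun u : EuclideanSpace ℝ (Fin n) => gradHeat j u t)
      (t ^ (-1 / 2 : ℝ) * (4 * Real.sqrt 2 ^ n)) (2 * t) where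
  meas := (continuous_gradHeat j ht).measurable
  nonneg := by positivity
  pos := by positivity
  le u := abs_gradHeat_le j u ht

variable {k f g : EuclideanSpace ℝ (Fin n) → ℝ} {c τ A : ℝ}

lemma GaussBound.integrable_dom (hk : GaussBound k c τ) (hf : Tame f A g)
    (y : EuclideanSpace ℝ (Fin n)) :
    Integrable (fun w => c * A * heatKernel (y - w) τ +
      c * (1 / Real.sqrt (2 * Real.pi * τ) ^ n) * g w) :=
  (((integrable_heatKernel hk.pos).comp_sub_left y).const_mul _).add (hf.integrable.const_mul _)

lemma GaussBound.ae_le (hk : GaussBound k c τ) (hf : Tame f A g) (y : EuclideanSpace ℝ (Fin n)) :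
    ∀ᵐ w, |k (y - w) * f w| ≤ c * A * heatKernel (y - w) τ +
      c * (1 / Real.sqrt (2 * Real.pi * τ) ^ n) * g w := by
  filter_upwards [hf.le] with w hw
  have h1 := hk.le (y - w)
  have h2 := heatKernel_le (y - w) hk.pos
  have h3 := heatKernel_nonneg (y - w) τ
  have h4 := hf.g_nonneg w
  have h5 := hk.nonneg
  rw [abs_mul]
  calc |k (y - w)| * |f w| ≤ c * heatKernel (y - w) τ * (A + g w) :=
        mul_le_mul h1 hw (abs_nonneg _) (by positivity)
    _ = c * A * heatKernel (y - w) τ + c * heatKernel (y - w) τ * g w := by ring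
    _ ≤ _ := by gcongr

lemma GaussBound.integrable (hk : GaussBound k c τ) (hf : Tame f A g)
    (y : EuclideanSpace ℝ (Fin n)) : Integrable (fun w => k (y - w) * f w) := by
  refine (hk.integrable_dom hf y).mono' ?_ (hk.ae_le hf y)
  exact (hk.meas.comp (by fun_prop)).aestronglyMeasurable.mul hf.meas

lemma GaussBound.integral_abs_le (hk : GaussBound k c τ) (hf : Tame f A g)
    (y : EuclideanSpace ℝ (Fin n)) :
    ∫ w, |k (y - w) * f w| ≤ c * A + c * (1 / Real.sqrt (2 * Real.pi * τ) ^ n) * ∫ w, g w := by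
  refine (integral_mono_ae (hk.integrable hf y).abs (hk.integrable_dom hf y)
    (hk.ae_le hf y)).trans_eq ?_
  rw [integral_add (((integrable_heatKernel hk.pos).comp_sub_left y).const_mul _)
    (hf.integrable.const_mul _), integral_const_mul, integral_const_mul,
    integral_sub_left_eq_self (fun w => heatKernel w τ), integral_heatKernel hk.pos, mul_one]

/-- Differentiation of a Gaussian convolution in the space variable. -/
lemma hasLineDerivAt_heatConv (hf : Tame f A g) {t : ℝ} (ht : 0 < t)
    (y : EuclideanSpace ℝ (Fin n)) (j : Fin n) :
    HasLineDerivAt ℝ (fun y => ∫ w, heatKernel (y - w) t * f w)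
      (∫ w, gradHeat j (y - w) t * f w) y (stdVec j) := by
  set c := t ^ (-1 / 2 : ℝ) * (4 * Real.sqrt 2 ^ n) with hc
  have hc0 : 0 ≤ c := by positivity
  -- Domination uniform in `|r| < 1`: bounding the gradient doubles the time to `2t`, and absorbing
  -- the translation by `r e_j` doubles it again.
  set c' := c * (Real.exp (1 / (2 * (2 * t))) * Real.sqrt 2 ^ n)
  have hdom : GaussBound (fun u : EuclideanSpace ℝ (Fin n) => c' * heatKernel u (2 * (2 * t))) c'
      (2 * (2 * t)) :=
    ⟨((continuous_heatKernel (by positivity)).measurable.const_mul _), by positivity,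
      by positivity, fun u => by
        rw [abs_of_nonneg]
        exact mul_nonneg (by positivity) (heatKernel_nonneg _ _)⟩
  have hshift : ∀ (r : ℝ) w, y + r • stdVec j - w = (y - w) + r • stdVec j := by
    intro r w; abel
  have key := hasDerivAt_integral_of_dominated_loc_of_deriv_le (μ := volume)
    (F := fun (r : ℝ) w => heatKernel (y + r • stdVec j - w) t * f w)
    (F' := fun (r : ℝ) w => gradHeat j (y + r • stdVec j - w) t * f w) (x₀ := 0)
    (s := Metric.ball 0 1)
    (bound := fun w => |c' * heatKernel (y - w) (2 * (2 * t)) * f w|)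
    (Metric.ball_mem_nhds 0 one_pos) ?_ ?_ ?_ ?_ ?_ ?_
  · have h := key.2
    simp only [zero_smul, add_zero] at h
    exact h
  · exact Eventually.of_forall fun r =>
      ((gaussBound_heatKernel ht).integrable hf _).aestronglyMeasurable
  · exact (gaussBound_heatKernel ht).integrable hf _
  · exact ((gaussBound_gradHeat j ht).integrable hf _).aestronglyMeasurable
  · refine Eventually.of_forall fun w r hr => ?_
    rw [Real.norm_eq_abs, abs_mul, abs_mul]
    refine mul_le_mul_of_nonneg_right ?_ (abs_nonneg _)
    rw [hshift, abs_of_nonneg (mul_nonneg (by positivity) (heatKernel_nonneg _ _))]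
    refine (abs_gradHeat_le j _ ht).trans ?_
    have := heatKernel_add_le (y - w) (r • stdVec j) (by
      rw [norm_smul, norm_stdVec, mul_one]
      rw [mem_ball_zero_iff] at hr
      exact hr.le) (by positivity : 0 < 2 * t)
    refine (mul_le_mul_of_nonneg_left this hc0).trans_eq ?_
    simp only [c']
    ring
  · exact (hdom.integrable hf y).abs
  · refine Eventually.of_forall fun w r _ => ?_
    have h := hasLineDerivAt_heatKernel (y + r • stdVec j - w) ht j
    rw [HasLineDerivAt] at h
    have h2 : HasDerivAt (fun r' => heatKernel (y + r' • stdVec j - w) t)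
        (gradHeat j (y + r • stdVec j - w) t) r := by
      have h3 : HasDerivAt
          (fun ρ : ℝ => heatKernel (y + r • stdVec j - w + ρ • stdVec j) t)
          (gradHeat j (y + r • stdVec j - w) t) (r - r) := by rwa [sub_self]
      have h4 := h3.comp_sub_const r r
      refine h4.congr_of_eventuallyEq (Eventually.of_forall fun ρ => ?_)
      simp only
      congr 1
      module
    exact h2.mul_const (f w)

/-- Integration by parts against a Gaussian kernel. -/
lemma integral_heatKernel_mul_deriv {f f' : EuclideanSpace ℝ (Fin n) → ℝ} {A A' t : ℝ}
    (ht : 0 < t) (hf : Measurable f) (hf' : Measurable f') (hA : ∀ w, |f w| ≤ A)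
    (hA' : ∀ w, |f' w| ≤ A') (j : Fin n) (h : ∀ w, HasLineDerivAt ℝ f (f' w) w (stdVec j))
    (y : EuclideanSpace ℝ (Fin n)) :
    ∫ w, heatKernel (y - w) t * f' w = ∫ w, gradHeat j (y - w) t * f w := by
  have hT := Tame.of_bounded hf hA
  have hT' := Tame.of_bounded hf' hA'
  have hd : ∀ w, HasLineDerivAt ℝ (fun w => heatKernel (y - w) t) (-gradHeat j (y - w) t) w
      (stdVec j) := by
    intro w
    have h0 := hasLineDerivAt_heatKernel (y - w) ht j
    rw [HasLineDerivAt] at h0 ⊢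
    rw [← neg_zero] at h0
    have h1 := h0.scomp (0 : ℝ) (hasDerivAt_neg (0 : ℝ))
    simp only [neg_smul, one_smul] at h1
    refine h1.congr_of_eventuallyEq (Eventually.of_forall fun ρ => ?_)
    simp only [Function.comp]
    congr 1
    module
  have key := integral_bilinear_hasLineDerivAt_right_eq_neg_left_of_integrable (μ := volume)
    (B := ContinuousLinearMap.mul ℝ ℝ) (v := stdVec j)
    (f := fun w => heatKernel (y - w) t) (f' := fun w => -gradHeat j (y - w) t) (g := f)
    (g' := f') ?_ ?_ ?_ (fun w _ => hd w) (fun w _ => h w)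
  · simpa [integral_neg] using key
  · simpa using ((gaussBound_gradHeat j ht).integrable hT y).neg
  · simpa using (gaussBound_heatKernel ht).integrable hT' y
  · simpa using (gaussBound_heatKernel ht).integrable hT y

/-- Differentiation of a Gaussian convolution with respect to a parameter. -/
lemma GaussBound.hasDerivAt_param (hk : GaussBound k c τ) {F F' : ℝ → EuclideanSpace ℝ (Fin n) → ℝ}
    {s ε A A' : ℝ} (hε : 0 < ε) (hF : ∀ σ, Measurable (F σ)) (hF' : ∀ σ, Measurable (F' σ))
    (hA : ∀ w, |F s w| ≤ A) (hA' : ∀ w, ∀ σ ∈ Metric.ball s ε, |F' σ w| ≤ A')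
    (h : ∀ w, ∀ σ ∈ Metric.ball s ε, HasDerivAt (fun σ => F σ w) (F' σ w) σ)
    (y : EuclideanSpace ℝ (Fin n)) :
    HasDerivAt (fun σ => ∫ w, k (y - w) * F σ w) (∫ w, k (y - w) * F' s w) s := by
  have hT := Tame.of_bounded (hF s) hA
  have hT' := Tame.of_bounded (hF' s) fun w => hA' w s (Metric.mem_ball_self hε)
  have hkm : Measurable fun w => k (y - w) := hk.meas.comp (by fun_prop)
  have hki : Integrable fun w => k (y - w) := by
    have := hk.integrable (f := fun _ => 1) (A := 1) (g := 0)
      (Tame.of_bounded measurable_const fun _ => by simp) y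
    simpa using this
  refine (hasDerivAt_integral_of_dominated_loc_of_deriv_le (μ := volume)
    (F := fun σ w => k (y - w) * F σ w) (F' := fun σ w => k (y - w) * F' σ w) (x₀ := s)
    (s := Metric.ball s ε) (bound := fun w => |k (y - w)| * A')
    (Metric.ball_mem_nhds s hε) ?_ ?_ ?_ ?_ ?_ ?_).2
  · exact Eventually.of_forall fun σ => (hkm.mul (hF σ)).aestronglyMeasurable
  · exact hk.integrable hT y
  · exact (hkm.mul (hF' s)).aestronglyMeasurable
  · refine Eventually.of_forall fun w σ hσ => ?_
    rw [Real.norm_eq_abs, abs_mul]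
    exact mul_le_mul_of_nonneg_left (hA' w σ hσ) (abs_nonneg _)
  · exact hki.abs.mul_const A'
  · exact Eventually.of_forall fun w σ hσ => (h w σ hσ).const_mul _

end Convolution

/-! ### Convolution of the Gaussian kernel with the gradient of `E` -/

section GradConv

variable {d : ℕ}

/-- `∫ Γ(y - w, t) D_i E(w, s) dw` over the tangential variable. -/
def gradConv (i : Fin (d + 1)) (y : EuclideanSpace ℝ (Fin d)) (s t : ℝ) : ℝ :=
  ∫ w, heatKernel (y - w) t * gradE i (join w s)

/-- `∫ D_j Γ(y - w, t) D_i E(w, s) dw` over the tangential variable. -/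
def gradConv' (i : Fin (d + 1)) (j : Fin d) (y : EuclideanSpace ℝ (Fin d)) (s t : ℝ) : ℝ :=
  ∫ w, gradHeat j (y - w) t * gradE i (join w s)

lemma measurable_gradE_join (i : Fin (d + 1)) (s : ℝ) :
    Measurable fun w : EuclideanSpace ℝ (Fin d) => gradE i (join w s) :=
  (measurable_gradE i).comp (by fun_prop)

lemma measurable_hessE_join (i : Fin (d + 1)) (s : ℝ) :
    Measurable fun w : EuclideanSpace ℝ (Fin d) => hessE i (join w s) :=
  (measurable_hessE i).comp (by fun_prop)

lemma measurable_laplaceFund_join (s : ℝ) :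
    Measurable fun w : EuclideanSpace ℝ (Fin d) => laplaceFund (join w s) :=
  measurable_laplaceFund.comp (by fun_prop)

lemma tame_gradE (i : Fin (d + 1)) {s : ℝ} (hs : 0 < s) :
    Tame (fun w : EuclideanSpace ℝ (Fin d) => gradE i (join w s)) (gradConst d)
      (fun w => gradConst d * ‖join w s‖ ^ (-(d : ℝ) - 1 / 2)) where
  meas := (measurable_gradE_join i s).aestronglyMeasurable
  nonneg := gradConst_nonneg
  g_nonneg _ := mul_nonneg gradConst_nonneg (by positivity)
  integrable := (integrable_profile hs).const_mul _
  le := Eventually.of_forall fun w => abs_gradE_join_le i w hs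

lemma tame_laplaceFund (hd : 1 ≤ d) (s : ℝ) :
    Tame (fun w : EuclideanSpace ℝ (Fin d) => laplaceFund (join w s)) |newtonConst d|
      (fun w => |newtonConst d| * boundaryProfile w) where
  meas := (measurable_laplaceFund_join s).aestronglyMeasurable
  nonneg := abs_nonneg _
  g_nonneg _ := mul_nonneg (abs_nonneg _) (indicator_nonneg (fun _ _ => by positivity) _)
  integrable := (integrable_boundaryProfile hd).const_mul _
  le := by
    have : Nonempty (Fin d) := ⟨⟨0, hd⟩⟩
    filter_upwards [compl_mem_ae_iff.2 (measure_singleton (0 : EuclideanSpace ℝ (Fin d)))]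
      with w hw
    exact abs_laplaceFund_join_le hd hw s

/-- `M` is independent of `y` and `s`, and `s^(-1/2)` is integrable at `0`: this supplies the
domination for every integral over `s ∈ (0, X)`. -/
lemma GaussBound.integral_abs_gradE_le {k : EuclideanSpace ℝ (Fin d) → ℝ} {c τ : ℝ}
    (hk : GaussBound k c τ) : ∃ M, 0 ≤ M ∧ ∀ (i : Fin (d + 1)) (y : EuclideanSpace ℝ (Fin d))
      (s : ℝ), 0 < s → ∫ w, |k (y - w) * gradE i (join w s)| ≤ M * (1 + s ^ (-1 / 2 : ℝ)) := by
  have hc := hk.nonneg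
  have hK := gradConst_nonneg (d := d)
  have hP := profileConst_nonneg (d := d)
  refine ⟨c * gradConst d + c * (1 / Real.sqrt (2 * Real.pi * τ) ^ d) *
    (gradConst d * profileConst d), by positivity, fun i y s hs => ?_⟩
  refine (hk.integral_abs_le (tame_gradE i hs) y).trans ?_
  rw [integral_const_mul, integral_profile hs]
  have h1 : 0 ≤ s ^ (-1 / 2 : ℝ) := by positivity
  have h2 : 0 ≤ c * gradConst d * s ^ (-1 / 2 : ℝ) := by positivity
  have h3 : 0 ≤ c * (1 / Real.sqrt (2 * Real.pi * τ) ^ d) * (gradConst d * profileConst d) := by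
    positivity
  nlinarith

lemma abs_gradConv_le {t : ℝ} (ht : 0 < t) : ∃ M, 0 ≤ M ∧ ∀ (i : Fin (d + 1))
    (y : EuclideanSpace ℝ (Fin d)) (s : ℝ), 0 < s →
      |gradConv i y s t| ≤ M * (1 + s ^ (-1 / 2 : ℝ)) := by
  obtain ⟨M, hM, h⟩ := (gaussBound_heatKernel (n := d) ht).integral_abs_gradE_le
  exact ⟨M, hM, fun i y s hs => (abs_integral_le_integral_abs).trans (h i y s hs)⟩

lemma abs_gradConv'_le (j : Fin d) {t : ℝ} (ht : 0 < t) : ∃ M, 0 ≤ M ∧ ∀ (i : Fin (d + 1))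
    (y : EuclideanSpace ℝ (Fin d)) (s : ℝ), 0 < s →
      |gradConv' i j y s t| ≤ M * (1 + s ^ (-1 / 2 : ℝ)) := by
  obtain ⟨M, hM, h⟩ := (gaussBound_gradHeat j ht).integral_abs_gradE_le
  exact ⟨M, hM, fun i y s hs => (abs_integral_le_integral_abs).trans (h i y s hs)⟩

lemma measurable_gradConv (i : Fin (d + 1)) :
    Measurable fun p : EuclideanSpace ℝ (Fin d) × ℝ × ℝ => gradConv i p.1 p.2.1 p.2.2 := by
  have h : Measurable fun q : (EuclideanSpace ℝ (Fin d) × ℝ × ℝ) × EuclideanSpace ℝ (Fin d) =>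
      heatKernel (q.1.1 - q.2) q.1.2.2 * gradE i (join q.2 q.1.2.1) :=
    (measurable_heatKernel.comp (f := fun q : (EuclideanSpace ℝ (Fin d) × ℝ × ℝ) ×
      EuclideanSpace ℝ (Fin d) => (q.1.1 - q.2, q.1.2.2)) (by fun_prop)).mul
      ((measurable_gradE i).comp (by fun_prop))
  exact h.stronglyMeasurable.integral_prod_right'.measurable

lemma measurable_gradConv' (i : Fin (d + 1)) (j : Fin d) :
    Measurable fun p : EuclideanSpace ℝ (Fin d) × ℝ × ℝ => gradConv' i j p.1 p.2.1 p.2.2 := by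
  have h : Measurable fun q : (EuclideanSpace ℝ (Fin d) × ℝ × ℝ) × EuclideanSpace ℝ (Fin d) =>
      gradHeat j (q.1.1 - q.2) q.1.2.2 * gradE i (join q.2 q.1.2.1) :=
    ((measurable_gradHeat j).comp (f := fun q : (EuclideanSpace ℝ (Fin d) × ℝ × ℝ) ×
      EuclideanSpace ℝ (Fin d) => (q.1.1 - q.2, q.1.2.2)) (by fun_prop)).mul
      ((measurable_gradE i).comp (by fun_prop))
  exact h.stronglyMeasurable.integral_prod_right'.measurable

lemma hasLineDerivAt_gradConv (i : Fin (d + 1)) (j : Fin d) (y : EuclideanSpace ℝ (Fin d))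
    {s t : ℝ} (hs : 0 < s) (ht : 0 < t) :
    HasLineDerivAt ℝ (fun y => gradConv i y s t) (gradConv' i j y s t) y (stdVec j) :=
  hasLineDerivAt_heatConv (tame_gradE i hs) ht y j

end GradConv

/-! ### The strip potential and its derivatives -/

section Strip

variable {d : ℕ}

lemma gaussN_mul_bound (z : ℝ) {t : ℝ} (ht : 0 < t) :
    (1 + z ^ 2 / t) * gaussN z t ≤ 4 / Real.sqrt (2 * Real.pi * t) := by
  have h := one_add_mul_exp_le (z ^ 2 / t)
  have h2 : Real.exp (-(z ^ 2 / t) / 4) ≤ 1 := by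
    refine Real.exp_le_one_iff.2 ?_
    have : 0 ≤ z ^ 2 / t := by positivity
    linarith
  rw [gaussN, show -z ^ 2 / (2 * t) = -(z ^ 2 / t) / 2 by field_simp]
  calc (1 + z ^ 2 / t) * (1 / Real.sqrt (2 * Real.pi * t) * Real.exp (-(z ^ 2 / t) / 2))
      = 1 / Real.sqrt (2 * Real.pi * t) * ((1 + z ^ 2 / t) * Real.exp (-(z ^ 2 / t) / 2)) := by ring
    _ ≤ 1 / Real.sqrt (2 * Real.pi * t) * 4 := by
      gcongr
      linarith
    _ = _ := by ring

lemma abs_gaussN'_le {t : ℝ} (ht : 0 < t) : ∃ B, 0 ≤ B ∧ ∀ z, |gaussN' z t| ≤ B := by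
  refine ⟨(1 + 1 / t) * (4 / Real.sqrt (2 * Real.pi * t)), by positivity, fun z => ?_⟩
  have h0 := gaussN_nonneg z t
  rw [gaussN', abs_mul, abs_neg, abs_of_nonneg h0]
  have h1 : |z / t| ≤ (1 + 1 / t) * (1 + z ^ 2 / t) := by
    rw [abs_div, abs_of_pos ht]
    have h2 : |z| ≤ 1 + z ^ 2 := by
      rw [← sq_abs]
      nlinarith [sq_nonneg (|z| - 1), abs_nonneg z]
    have h3 : |z| / t ≤ (1 + z ^ 2) / t := by gcongr
    have h4 : 0 ≤ 1 / t * (z ^ 2 / t) := by positivity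
    calc |z| / t ≤ (1 + z ^ 2) / t := h3
      _ = 1 / t + z ^ 2 / t := by ring
      _ ≤ (1 + 1 / t) * (1 + z ^ 2 / t) := by nlinarith
  calc |z / t| * gaussN z t ≤ (1 + 1 / t) * (1 + z ^ 2 / t) * gaussN z t := by gcongr
    _ = (1 + 1 / t) * ((1 + z ^ 2 / t) * gaussN z t) := by ring
    _ ≤ _ := by
      have := gaussN_mul_bound z ht
      gcongr

lemma abs_gaussN''_le {t : ℝ} (ht : 0 < t) : ∃ B, 0 ≤ B ∧ ∀ z, |gaussN'' z t| ≤ B := by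
  refine ⟨1 / t * (4 / Real.sqrt (2 * Real.pi * t)), by positivity, fun z => ?_⟩
  have h0 := gaussN_nonneg z t
  rw [gaussN'', abs_mul, abs_of_nonneg h0]
  have h1 : |z ^ 2 / t ^ 2 - 1 / t| ≤ 1 / t * (1 + z ^ 2 / t) := by
    have h3 : 0 ≤ 1 / t := by positivity
    have h4 : 0 ≤ z ^ 2 / t ^ 2 := by positivity
    have h5 : 1 / t * (1 + z ^ 2 / t) = 1 / t + z ^ 2 / t ^ 2 := by field_simp
    rw [h5, abs_le]
    constructor <;> linarith
  calc |z ^ 2 / t ^ 2 - 1 / t| * gaussN z t ≤ 1 / t * (1 + z ^ 2 / t) * gaussN z t := by gcongr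
    _ = 1 / t * ((1 + z ^ 2 / t) * gaussN z t) := by ring
    _ ≤ _ := by
      have := gaussN_mul_bound z ht
      gcongr

lemma stripIntegrand_join {i : Fin (d + 1)} {x : EuclideanSpace ℝ (Fin (d + 1))} {t s : ℝ}
    (ht : 0 < t) (hs : s < x (Fin.last d)) (z : EuclideanSpace ℝ (Fin d)) :
    stripIntegrand i x t (join z s) =
      gaussN' s t * (heatKernel z t * gradE i (join (tang x - z) (x (Fin.last d) - s))) := by
  rw [stripIntegrand, pderiv_heatKernel_join z s ht, sub_join,
    pderiv_laplaceFund (norm_pos_iff.1 (norm_join_pos _ (sub_pos.2 hs))), mul_assoc]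

lemma integral_stripIntegrand {i : Fin (d + 1)} {x : EuclideanSpace ℝ (Fin (d + 1))} {t s : ℝ}
    (ht : 0 < t) (hs : s < x (Fin.last d)) :
    ∫ z, stripIntegrand i x t (join z s) =
      gaussN' s t * gradConv i (tang x) (x (Fin.last d) - s) t := by
  simp_rw [stripIntegrand_join ht hs]
  rw [integral_const_mul, gradConv, ← integral_sub_left_eq_self _ volume (tang x)]
  simp_rw [sub_sub_cancel]

/-- The endpoint `b` is discarded because at the top of the strip the argument of `E` can be the
origin. -/
lemma ae_lt_of_Ioc (a b : ℝ) : ∀ᵐ s ∂(volume.restrict (Ioc a b)), a < s ∧ s < b := by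
  have h1 := ae_restrict_mem (μ := volume) (measurableSet_Ioc (a := a) (b := b))
  have h2 : ∀ᵐ s ∂(volume.restrict (Ioc a b)), s ≠ b :=
    ae_restrict_of_ae (compl_mem_ae_iff.2 (measure_singleton b))
  filter_upwards [h1, h2] with s hs hsb
  exact ⟨hs.1, lt_of_le_of_ne hs.2 hsb⟩

/-- The reflection `s ↦ x_n - s` moves `x_n` from `E` to the smooth factor, so normal derivatives
never meet the singularity of `E`. -/
lemma stripPotential_eq (i : Fin (d + 1)) {x : EuclideanSpace ℝ (Fin (d + 1))} {t : ℝ}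
    (ht : 0 < t) (hx : 0 < x (Fin.last d)) :
    stripPotential i x t =
      ∫ s in (0 : ℝ)..x (Fin.last d), gaussN' (x (Fin.last d) - s) t * gradConv i (tang x) s t := by
  have h := intervalIntegral.integral_comp_sub_left (a := 0) (b := x (Fin.last d))
    (fun s => gaussN' (x (Fin.last d) - s) t * gradConv i (tang x) s t) (x (Fin.last d))
  rw [sub_self, sub_zero] at h
  rw [← h, stripPotential, intervalIntegral.integral_of_le hx.le,
    intervalIntegral.integral_of_le hx.le]
  refine integral_congr_ae ?_
  filter_upwards [ae_lt_of_Ioc 0 (x (Fin.last d))] with s hs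
  rw [integral_stripIntegrand ht hs.2, sub_sub_cancel]

lemma intervalIntegrable_one_add_rpow (M X : ℝ) :
    IntervalIntegrable (fun s : ℝ => M * (1 + s ^ (-1 / 2 : ℝ))) volume 0 X :=
  ((intervalIntegrable_const (c := (1 : ℝ))).add (intervalIntegrable_rpow_neg_half X)).const_mul M

lemma intervalIntegrable_of_abs_le {m : ℝ → ℝ} (hm : Measurable m) {M : ℝ}
    (h : ∀ s, 0 < s → |m s| ≤ M * (1 + s ^ (-1 / 2 : ℝ))) {X : ℝ} (hX : 0 ≤ X) :
    IntervalIntegrable m volume 0 X := by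
  refine (intervalIntegrable_one_add_rpow M X).mono_fun' hm.aestronglyMeasurable ?_
  rw [uIoc_of_le hX]
  filter_upwards [ae_restrict_mem measurableSet_Ioc] with s hs
  exact h s hs.1

lemma intervalIntegrable_bdd_mul {a m : ℝ → ℝ} (ha : Measurable a) {B : ℝ}
    (hB : ∀ s, |a s| ≤ B) {X : ℝ} (hm : IntervalIntegrable m volume 0 X) :
    IntervalIntegrable (fun s => a s * m s) volume 0 X := by
  rw [intervalIntegrable_iff] at hm ⊢
  exact hm.bdd_mul ha.aestronglyMeasurable (Eventually.of_forall hB)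

lemma measurable_gradConv_normal (i : Fin (d + 1)) (y : EuclideanSpace ℝ (Fin d)) (t : ℝ) :
    Measurable fun s => gradConv i y s t :=
  (measurable_gradConv i).comp (f := fun s : ℝ => (y, s, t)) (by fun_prop)

lemma measurable_gradConv'_normal (i : Fin (d + 1)) (j : Fin d) (y : EuclideanSpace ℝ (Fin d))
    (t : ℝ) : Measurable fun s => gradConv' i j y s t :=
  (measurable_gradConv' i j).comp (f := fun s : ℝ => (y, s, t)) (by fun_prop)

lemma intervalIntegrable_gradConv (i : Fin (d + 1)) (y : EuclideanSpace ℝ (Fin d)) {t X : ℝ}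
    (ht : 0 < t) (hX : 0 ≤ X) : IntervalIntegrable (fun s => gradConv i y s t) volume 0 X := by
  obtain ⟨M, -, hM⟩ := abs_gradConv_le (d := d) ht
  exact intervalIntegrable_of_abs_le (measurable_gradConv_normal i y t) (hM i y) hX

lemma intervalIntegrable_gradConv' (i : Fin (d + 1)) (j : Fin d) (y : EuclideanSpace ℝ (Fin d))
    {t X : ℝ} (ht : 0 < t) (hX : 0 ≤ X) :
    IntervalIntegrable (fun s => gradConv' i j y s t) volume 0 X := by
  obtain ⟨M, -, hM⟩ := abs_gradConv'_le (d := d) j ht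
  exact intervalIntegrable_of_abs_le (measurable_gradConv'_normal i j y t) (hM i y) hX

/-- `∫_0^{x_n} D_n Γ(x_n - s, t) (D_j Γ * D_i E)(s) ds`, the tangential derivative of the strip
potential. -/
def tangKernel (i : Fin (d + 1)) (j : Fin d) (y : EuclideanSpace ℝ (Fin d)) (X t : ℝ) : ℝ :=
  ∫ s in (0 : ℝ)..X, gaussN' (X - s) t * gradConv' i j y s t

lemma hasLineDerivAt_stripPotential_castSucc (i : Fin (d + 1)) (j : Fin d)
    {x : EuclideanSpace ℝ (Fin (d + 1))} {t : ℝ} (ht : 0 < t) (hx : 0 < x (Fin.last d)) :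
    HasLineDerivAt ℝ (fun y => stripPotential i y t)
      (tangKernel i j (tang x) (x (Fin.last d)) t) x (stdVec j.castSucc) := by
  set X := x (Fin.last d)
  obtain ⟨M, hM0, hM⟩ := abs_gradConv'_le (d := d) j ht
  obtain ⟨B, hB0, hB⟩ := abs_gaussN'_le ht
  have hmeas : Measurable fun s => gaussN' (X - s) t :=
    ((continuous_gaussN' t).measurable).comp (by fun_prop)
  have heq : ∀ r : ℝ, stripPotential i (x + r • stdVec j.castSucc) t =
      ∫ s in (0 : ℝ)..X, gaussN' (X - s) t * gradConv i (tang x + r • stdVec j) s t := by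
    intro r
    rw [stripPotential_eq i ht (by rwa [last_add_smul_castSucc]), last_add_smul_castSucc,
      tang_add_smul_castSucc]
  rw [HasLineDerivAt]
  simp_rw [heq]
  have key := (intervalIntegral.hasDerivAt_integral_of_dominated_loc_of_deriv_le (a := 0) (b := X)
    (μ := volume)
    (F := fun (r : ℝ) s => gaussN' (X - s) t * gradConv i (tang x + r • stdVec j) s t)
    (F' := fun (r : ℝ) s => gaussN' (X - s) t * gradConv' i j (tang x + r • stdVec j) s t)
    (x₀ := 0) (s := univ) (bound := fun s => B * (M * (1 + s ^ (-1 / 2 : ℝ)))) univ_mem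
    ?_ ?_ ?_ ?_ ?_ ?_).2
  · simpa [tangKernel] using key
  · exact Eventually.of_forall fun r =>
      (hmeas.mul (measurable_gradConv_normal i _ t)).aestronglyMeasurable
  · exact intervalIntegrable_bdd_mul hmeas (fun s => hB _)
      (intervalIntegrable_gradConv i _ ht hx.le)
  · exact (hmeas.mul (measurable_gradConv'_normal i j _ t)).aestronglyMeasurable
  · refine Eventually.of_forall fun s hs r _ => ?_
    rw [uIoc_of_le hx.le] at hs
    rw [Real.norm_eq_abs, abs_mul]
    exact mul_le_mul (hB _) (hM i _ s hs.1) (abs_nonneg _) hB0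
  · exact (intervalIntegrable_one_add_rpow M X).const_mul B
  · refine Eventually.of_forall fun s hs r _ => ?_
    rw [uIoc_of_le hx.le] at hs
    have h := hasLineDerivAt_gradConv i j (tang x + r • stdVec j) hs.1 ht
    rw [HasLineDerivAt] at h
    have h3 : HasDerivAt (fun ρ : ℝ => gradConv i (tang x + r • stdVec j + ρ • stdVec j) s t)
        (gradConv' i j (tang x + r • stdVec j) s t) (r - r) := by rwa [sub_self]
    have h4 := h3.comp_sub_const r r
    refine (h4.congr_of_eventuallyEq (Eventually.of_forall fun ρ => ?_)).const_mul _
    simp only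
    congr 1
    module

/-- Differentiation of a Volterra convolution whose kernel vanishes at the origin. -/
lemma hasDerivAt_volterra {a b m : ℝ → ℝ} (ha : ∀ u, HasDerivAt a (b u) u) (ha0 : a 0 = 0)
    {B : ℝ} (hB : ∀ u, |b u| ≤ B) (hb : Continuous b)
    (hm : ∀ X, 0 ≤ X → IntervalIntegrable m volume 0 X) {X : ℝ} (hX : 0 < X) :
    HasDerivAt (fun X => ∫ s in (0 : ℝ)..X, a (X - s) * m s)
      (∫ s in (0 : ℝ)..X, b (X - s) * m s) X := by
  have hB0 : 0 ≤ B := (abs_nonneg _).trans (hB 0)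
  have hac : Continuous a := continuous_iff_continuousAt.2 fun u => (ha u).continuousAt
  have hL : ∀ u v, |a u - a v| ≤ B * |u - v| := fun u v => by
    have := (convex_univ).norm_image_sub_le_of_norm_hasDerivWithin_le (f := a) (f' := b) (C := B)
      (fun x _ => (ha x).hasDerivWithinAt) (fun x _ => hB x) (mem_univ v) (mem_univ u)
    simpa using this
  set Y := X + 1
  have hY : 0 ≤ Y := by positivity
  have hmY := hm Y hY
  -- Since `a 0 = 0`, truncating the argument at `0` extends the integrand by zero beyond `Z`. The
  -- moving endpoint disappears; on the fixed interval `(0, X + 1)` the integrand is Lipschitz in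
  -- `Z` and differentiable at `Z = X` for every `s ≠ X`.
  have hext : ∀ Z, 0 < Z → Z < Y →
      ∫ s in (0 : ℝ)..Z, a (Z - s) * m s = ∫ s in (0 : ℝ)..Y, a (max (Z - s) 0) * m s := by
    intro Z hZ hZY
    have hi : ∀ W, 0 ≤ W → IntervalIntegrable (fun s => a (max (Z - s) 0) * m s) volume 0 W :=
      fun W hW => (hm W hW).continuousOn_mul (by fun_prop)
    rw [← intervalIntegral.integral_add_adjacent_intervals (hi Z hZ.le)
      ((hi Z hZ.le).symm.trans (hi Y hY))]
    have h0 : ∫ s in Z..Y, a (max (Z - s) 0) * m s = 0 := by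
      refine (intervalIntegral.integral_congr fun s hs => ?_).trans intervalIntegral.integral_zero
      rw [uIcc_of_le hZY.le] at hs
      rw [max_eq_right (by linarith [hs.1]), ha0, zero_mul]
    rw [h0, add_zero]
    refine intervalIntegral.integral_congr fun s hs => ?_
    rw [uIcc_of_le hZ.le] at hs
    rw [max_eq_left (by linarith [hs.2])]
  have key := (intervalIntegral.hasDerivAt_integral_of_dominated_loc_of_lip (a := 0) (b := Y)
    (μ := volume) (F := fun Z s => a (max (Z - s) 0) * m s)
    (F' := (Iic X).indicator fun s => b (X - s) * m s) (x₀ := X)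
    (s := univ) (bound := fun s => B * |m s|) univ_mem ?_ ?_ ?_ ?_ ?_ ?_).2
  · have hF : ∫ s in (0 : ℝ)..Y, (Iic X).indicator (fun s => b (X - s) * m s) s =
        ∫ s in (0 : ℝ)..X, b (X - s) * m s := by
      rw [intervalIntegral.integral_of_le hY, intervalIntegral.integral_of_le hX.le,
        setIntegral_indicator measurableSet_Iic]
      congr 2
      ext s
      simp only [mem_inter_iff, mem_Ioc, mem_Iic, Y]
      constructor
      · rintro ⟨⟨h1, -⟩, h2⟩; exact ⟨h1, h2⟩
      · rintro ⟨h1, h2⟩; exact ⟨⟨h1, by linarith⟩, h2⟩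
    rw [hF] at key
    refine key.congr_of_eventuallyEq ?_
    filter_upwards [Ioo_mem_nhds hX (lt_add_one X)] with Z hZ
    exact hext Z hZ.1 hZ.2
  · refine Eventually.of_forall fun Z => ?_
    exact (by fun_prop : Continuous fun s => a (max (Z - s) 0)).aestronglyMeasurable.mul
      (intervalIntegrable_iff.1 hmY).aestronglyMeasurable
  · exact hmY.continuousOn_mul (by fun_prop)
  · exact ((by fun_prop : Continuous fun s => b (X - s)).aestronglyMeasurable.mul
      (intervalIntegrable_iff.1 hmY).aestronglyMeasurable).indicator measurableSet_Iic
  · refine Eventually.of_forall fun s _ => LipschitzOnWith.of_dist_le_mul fun u _ v _ => ?_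
    have h1 := hL (max (u - s) 0) (max (v - s) 0)
    have h2 := abs_max_sub_max_le_abs (u - s) (v - s) 0
    rw [sub_sub_sub_cancel_right] at h2
    rw [Real.dist_eq, Real.dist_eq, ← sub_mul, abs_mul, Real.coe_nnabs,
      abs_of_nonneg (mul_nonneg hB0 (abs_nonneg _))]
    calc |a (max (u - s) 0) - a (max (v - s) 0)| * |m s| ≤ B * |u - v| * |m s| := by
          refine mul_le_mul_of_nonneg_right (h1.trans ?_) (abs_nonneg _)
          gcongr
      _ = _ := by ring
  · exact hmY.abs.const_mul B
  · have hne : ∀ᵐ s : ℝ, s ≠ X := compl_mem_ae_iff.2 (measure_singleton X)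
    filter_upwards [hne] with s hs _
    rcases lt_or_gt_of_ne hs with h | h
    · rw [indicator_of_mem (mem_Iic.2 h.le)]
      have h1 : HasDerivAt (fun Z => a (Z - s)) (b (X - s)) X := (ha (X - s)).comp_sub_const X s
      refine (h1.congr_of_eventuallyEq ?_).mul_const (m s)
      filter_upwards [Ioi_mem_nhds h] with Z hZ
      rw [max_eq_left (sub_nonneg.2 (mem_Ioi.1 hZ).le)]
    · rw [indicator_of_notMem (by simpa using h)]
      refine (hasDerivAt_const X (0 : ℝ)).congr_of_eventuallyEq ?_
      filter_upwards [Iio_mem_nhds h] with Z hZ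
      rw [max_eq_right (sub_nonpos.2 (mem_Iio.1 hZ).le), ha0, zero_mul]

lemma hasLineDerivAt_stripPotential_last (i : Fin (d + 1))
    {x : EuclideanSpace ℝ (Fin (d + 1))} {t : ℝ} (ht : 0 < t) (hx : 0 < x (Fin.last d)) :
    HasLineDerivAt ℝ (fun y => stripPotential i y t)
      (∫ s in (0 : ℝ)..x (Fin.last d),
        gaussN'' (x (Fin.last d) - s) t * gradConv i (tang x) s t) x (stdVec (Fin.last d)) := by
  set X := x (Fin.last d)
  obtain ⟨B, -, hB⟩ := abs_gaussN''_le ht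
  have h := hasDerivAt_volterra (fun u => hasDerivAt_gaussN' u t) (gaussN'_zero t) hB
    (continuous_gaussN'' t) (m := fun s => gradConv i (tang x) s t)
    (fun Y hY => intervalIntegrable_gradConv i _ ht hY) hx
  have h1 : HasDerivAt (fun r : ℝ => ∫ s in (0 : ℝ)..(X + r),
      gaussN' (X + r - s) t * gradConv i (tang x) s t)
      (∫ s in (0 : ℝ)..X, gaussN'' (X - s) t * gradConv i (tang x) s t) 0 := by
    have h0 : HasDerivAt (fun Z => ∫ s in (0 : ℝ)..Z, gaussN' (Z - s) t * gradConv i (tang x) s t)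
      (∫ s in (0 : ℝ)..X, gaussN'' (X - s) t * gradConv i (tang x) s t) (X + 0) := by
      rwa [add_zero]
    exact h0.comp_const_add X 0
  rw [HasLineDerivAt]
  refine h1.congr_of_eventuallyEq ?_
  filter_upwards [Ioi_mem_nhds (neg_lt_zero.2 hx)] with r hr
  rw [stripPotential_eq i ht (by rw [last_add_smul_last]; linarith [mem_Ioi.1 hr]),
    last_add_smul_last, tang_add_smul_last]

lemma kernelL_castSucc (i : Fin (d + 1)) (j : Fin d) (y : EuclideanSpace ℝ (Fin d)) {X t : ℝ}
    (hX : 0 < X) (ht : 0 < t) :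
    kernelL i j.castSucc (join y X) t = tangKernel i j y X t := by
  have h := hasLineDerivAt_stripPotential_castSucc i j (x := join y X) ht (by simpa using hX)
  rw [tang_join, join_last] at h
  exact h.lineDeriv

lemma kernelL_last (i : Fin (d + 1)) (y : EuclideanSpace ℝ (Fin d)) {X t : ℝ}
    (hX : 0 < X) (ht : 0 < t) :
    kernelL i (Fin.last d) (join y X) t =
      ∫ s in (0 : ℝ)..X, gaussN'' (X - s) t * gradConv i y s t := by
  have h := hasLineDerivAt_stripPotential_last i (x := join y X) ht (by simpa using hX)
  rw [tang_join, join_last] at h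
  exact h.lineDeriv

/-- By Fubini: the slice at height `s` has norm of order `1 + (x_n - s)^(-1/2)`, which is integrable
up to the top of the strip. -/
lemma integrable_stripIntegrand (i : Fin (d + 1)) {x : EuclideanSpace ℝ (Fin (d + 1))} {t : ℝ}
    (ht : 0 < t) (hx : 0 < x (Fin.last d)) :
    Integrable (fun p : ℝ × EuclideanSpace ℝ (Fin d) => stripIntegrand i x t (join p.2 p.1))
      ((volume.restrict (Ioc 0 (x (Fin.last d)))).prod volume) := by
  set X := x (Fin.last d) with hX
  set F : ℝ × EuclideanSpace ℝ (Fin d) → ℝ := fun p =>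
    gaussN' p.1 t * (heatKernel p.2 t * gradE i (join (tang x - p.2) (X - p.1)))
  have hFm : Measurable F := by
    refine ((continuous_gaussN' t).measurable.comp measurable_fst).mul
      (((continuous_heatKernel ht).measurable.comp measurable_snd).mul
      ((measurable_gradE i).comp (by fun_prop)))
  have hsub : ∀ s, (fun z => heatKernel z t * gradE i (join (tang x - z) (X - s))) =
      fun z => (fun w => heatKernel (tang x - w) t * gradE i (join w (X - s))) (tang x - z) := by
    intro s
    funext z
    simp only [sub_sub_cancel]
  obtain ⟨B, hB0, hB⟩ := abs_gaussN'_le ht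
  obtain ⟨M, hM0, hM⟩ := (gaussBound_heatKernel (n := d) ht).integral_abs_gradE_le
  have hF : Integrable F ((volume.restrict (Ioc 0 X)).prod volume) := by
    rw [integrable_prod_iff hFm.aestronglyMeasurable]
    constructor
    · filter_upwards [ae_lt_of_Ioc 0 X] with s hs
      have h2 := ((gaussBound_heatKernel ht).integrable (tame_gradE i (sub_pos.2 hs.2))
        (tang x)).comp_sub_left (tang x)
      rw [← hsub] at h2
      exact h2.const_mul (gaussN' s t)
    · have hdom : IntegrableOn (fun s => B * (M * (1 + (X - s) ^ (-1 / 2 : ℝ)))) (Ioc 0 X) := by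
        have := (intervalIntegrable_one_add_rpow M X).comp_sub_left X
        rw [sub_self, sub_zero] at this
        exact ((intervalIntegrable_iff_integrableOn_Ioc_of_le hx.le).1 this.symm).const_mul B
      refine hdom.mono' (hFm.norm.stronglyMeasurable.integral_prod_right').aestronglyMeasurable ?_
      filter_upwards [ae_lt_of_Ioc 0 X] with s hs
      rw [Real.norm_of_nonneg (integral_nonneg fun _ => norm_nonneg _)]
      have hn : ∀ z, ‖F (s, z)‖ = ‖gaussN' s t‖ *
          ‖heatKernel z t * gradE i (join (tang x - z) (X - s))‖ := fun z => norm_mul _ _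
      simp_rw [hn]
      rw [integral_const_mul]
      refine mul_le_mul (hB s) ?_ (integral_nonneg fun _ => norm_nonneg _) hB0
      have h1 := integral_sub_left_eq_self
        (fun w => ‖heatKernel (tang x - w) t * gradE i (join w (X - s))‖) volume (tang x)
      simp only [sub_sub_cancel] at h1
      rw [h1]
      exact hM i (tang x) (X - s) (sub_pos.2 hs.2)
  refine hF.congr ?_
  have hae : ∀ᵐ p ∂((volume.restrict (Ioc 0 X)).prod (volume : Measure (EuclideanSpace ℝ (Fin d)))),
      p.1 < X :=
    Measure.quasiMeasurePreserving_fst.ae ((ae_lt_of_Ioc 0 X).mono fun s hs => hs.2)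
  filter_upwards [hae] with p hp
  exact (stripIntegrand_join ht hp p.2).symm

end Strip

/-! ### The composite kernel and the normal derivatives -/

section Normal

variable {d : ℕ}

/-- `∫ D_j Γ(y - w, t) E(w, s) dw` over the tangential variable. -/
def potConv (j : Fin d) (y : EuclideanSpace ℝ (Fin d)) (s t : ℝ) : ℝ :=
  ∫ w, gradHeat j (y - w) t * laplaceFund (join w s)

lemma kappaIntegrand_eq (x : EuclideanSpace ℝ (Fin (d + 1))) {t : ℝ} (ht : 0 < t)
    (z : EuclideanSpace ℝ (Fin d)) :
    kappaIntegrand x t z = gaussN' (x (Fin.last d)) t *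
      (heatKernel (tang x - z) t * laplaceFund (join z 0)) := by
  rw [kappaIntegrand, pderiv_heatKernel_join _ _ ht, mul_assoc]

lemma integrable_kappaIntegrand (hd : 1 ≤ d) (x : EuclideanSpace ℝ (Fin (d + 1))) {t : ℝ}
    (ht : 0 < t) : Integrable (kappaIntegrand x t) := by
  rw [show kappaIntegrand x t = _ from funext (kappaIntegrand_eq x ht)]
  exact ((gaussBound_heatKernel ht).integrable (tame_laplaceFund hd 0) (tang x)).const_mul _

lemma hasLineDerivAt_kappa (hd : 1 ≤ d) (x : EuclideanSpace ℝ (Fin (d + 1))) {t : ℝ}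
    (ht : 0 < t) (j : Fin d) :
    HasLineDerivAt ℝ (fun y => kappa y t)
      (gaussN' (x (Fin.last d)) t * potConv j (tang x) 0 t) x (stdVec j.castSucc) := by
  have h := hasLineDerivAt_heatConv (tame_laplaceFund hd 0) ht (tang x) j
  rw [HasLineDerivAt] at h ⊢
  refine (h.const_mul _).congr_of_eventuallyEq (Eventually.of_forall fun r => ?_)
  simp only [kappa, kappaIntegrand_eq _ ht, last_add_smul_castSucc, tang_add_smul_castSucc]
  rw [integral_const_mul]

lemma kernelB_castSucc (hd : 1 ≤ d) (y : EuclideanSpace ℝ (Fin d)) (X : ℝ) {t : ℝ}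
    (ht : 0 < t) (j : Fin d) :
    kernelB j.castSucc (join y X) t = gaussN' X t * potConv j y 0 t := by
  have h := hasLineDerivAt_kappa hd (join y X) ht j
  rw [join_last, tang_join] at h
  rw [kernelB, if_neg (Fin.castSucc_lt_last j).ne]
  exact h.lineDeriv

lemma kernelB_last (x : EuclideanSpace ℝ (Fin (d + 1))) (t : ℝ) :
    kernelB (Fin.last d) x t = 0 := if_pos rfl

lemma norm_join_rpow_le (w : EuclideanSpace ℝ (Fin d)) {s σ p : ℝ} (hs : 0 < s) (hσ : s ≤ σ)
    (hp : p ≤ 0) : ‖join w σ‖ ^ p ≤ s ^ p :=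
  Real.rpow_le_rpow_of_nonpos hs (hσ.trans ((le_abs_self σ).trans (abs_le_norm_join w σ))) hp

lemma abs_laplaceFund_join_le_rpow (hd : 1 ≤ d) (w : EuclideanSpace ℝ (Fin d)) {s : ℝ}
    (hs : 0 < s) : |laplaceFund (join w s)| ≤ |newtonConst d| * s ^ (1 - (d : ℝ)) := by
  have hd' : (1 : ℝ) ≤ d := by exact_mod_cast hd
  rw [laplaceFund_eq, abs_mul, abs_neg,
    abs_of_nonneg (a := ‖join w s‖ ^ (1 - (d : ℝ))) (by positivity)]
  exact mul_le_mul_of_nonneg_left (norm_join_rpow_le w hs le_rfl (by linarith)) (abs_nonneg _)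

lemma abs_gradE_join_le_rpow (i : Fin (d + 1)) (w : EuclideanSpace ℝ (Fin d)) {s σ : ℝ}
    (hs : 0 < s) (hσ : s ≤ σ) : |gradE i (join w σ)| ≤ gradConst d * s ^ (-(d : ℝ)) := by
  refine (abs_gradE_le (norm_pos_iff.1 (norm_join_pos w (hs.trans_le hσ))) i).trans ?_
  exact mul_le_mul_of_nonneg_left (norm_join_rpow_le w hs hσ (by simp)) gradConst_nonneg

lemma abs_hessE_join_le_rpow (i : Fin (d + 1)) (w : EuclideanSpace ℝ (Fin d)) {s σ : ℝ}
    (hs : 0 < s) (hσ : s ≤ σ) :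
    |hessE i (join w σ)| ≤ gradConst d * ((d + 2) * s ^ (-(d : ℝ) - 1)) := by
  have hd : (0 : ℝ) ≤ d := Nat.cast_nonneg d
  refine (abs_hessE_le (norm_pos_iff.1 (norm_join_pos w (hs.trans_le hσ))) i).trans ?_
  have := norm_join_rpow_le w hs hσ (show -(d : ℝ) - 1 ≤ 0 by linarith)
  have := gradConst_nonneg (d := d)
  gcongr

lemma half_le_of_mem_ball {s σ : ℝ} (hσ : σ ∈ Metric.ball s (s / 2)) : s / 2 ≤ σ := by
  rw [Real.ball_eq_Ioo] at hσ
  linarith [hσ.1]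

/-- The derivative moves from `E` to the Gaussian; the height `s > 0` keeps `E` bounded. The new
form survives `s → 0`, since `E(·, 0)` is locally integrable while the bound `‖w‖^(-d)` for its
gradient is not. -/
lemma gradConv_castSucc (hd : 1 ≤ d) (j : Fin d) (y : EuclideanSpace ℝ (Fin d)) {s t : ℝ}
    (hs : 0 < s) (ht : 0 < t) : gradConv j.castSucc y s t = potConv j y s t :=
  integral_heatKernel_mul_deriv ht (measurable_laplaceFund_join s) (measurable_gradE_join _ s)
    (fun w => abs_laplaceFund_join_le_rpow hd w hs)
    (fun w => abs_gradE_join_le_rpow _ w hs le_rfl) j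
    (fun w => hasLineDerivAt_of_castSucc
      (hasLineDerivAt_laplaceFund (norm_pos_iff.1 (norm_join_pos w hs)) _)) y

lemma hasDerivAt_potConv (hd : 1 ≤ d) (j : Fin d) (y : EuclideanSpace ℝ (Fin d)) {s t : ℝ}
    (hs : 0 < s) (ht : 0 < t) :
    HasDerivAt (fun s => potConv j y s t) (gradConv' (Fin.last d) j y s t) s :=
  (gaussBound_gradHeat j ht).hasDerivAt_param (F := fun σ w => laplaceFund (join w σ))
    (F' := fun σ w => gradE (Fin.last d) (join w σ)) (half_pos hs)
    measurable_laplaceFund_join (measurable_gradE_join _)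
    (fun w => abs_laplaceFund_join_le_rpow hd w hs)
    (fun w _ hσ => abs_gradE_join_le_rpow _ w (half_pos hs) (half_le_of_mem_ball hσ))
    (fun w _ hσ => hasDerivAt_of_hasLineDerivAt_last (hasLineDerivAt_laplaceFund
      (norm_pos_iff.1 (norm_join_pos w ((half_pos hs).trans_le (half_le_of_mem_ball hσ)))) _)) y

lemma tendsto_potConv (hd : 1 ≤ d) (j : Fin d) (y : EuclideanSpace ℝ (Fin d)) {t : ℝ}
    (ht : 0 < t) :
    Tendsto (fun s => potConv j y s t) (𝓝[>] 0) (𝓝 (potConv j y 0 t)) := by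
  refine tendsto_integral_filter_of_dominated_convergence _
    (Eventually.of_forall fun s =>
      ((gaussBound_gradHeat j ht).integrable (tame_laplaceFund hd s) y).aestronglyMeasurable)
    (Eventually.of_forall fun s => (gaussBound_gradHeat j ht).ae_le (tame_laplaceFund hd s) y)
    ((gaussBound_gradHeat j ht).integrable_dom (tame_laplaceFund hd 0) y) ?_
  have : Nonempty (Fin d) := ⟨⟨0, hd⟩⟩
  filter_upwards [compl_mem_ae_iff.2 (measure_singleton (0 : EuclideanSpace ℝ (Fin d)))] with w hw
  refine Tendsto.const_mul _ (Tendsto.mono_left ?_ nhdsWithin_le_nhds)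
  have hw0 : ‖join w 0‖ ≠ 0 := by
    rw [norm_join_zero]
    exact norm_ne_zero_iff.2 hw
  simp_rw [laplaceFund_eq]
  have hc : ContinuousAt (fun s : ℝ => ‖join w s‖) 0 := by fun_prop
  exact (hc.rpow_const (Or.inl hw0)).const_mul _ |>.tendsto

/-- Integration by parts in a Volterra convolution whose kernel vanishes at the origin. -/
lemma volterra_parts {a b M M' : ℝ → ℝ} (ha : ∀ u, HasDerivAt a (b u) u) (ha0 : a 0 = 0)
    (hb : Continuous b) {X L : ℝ} (hX : 0 < X) (hM : ∀ s, 0 < s → HasDerivAt M (M' s) s)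
    (hL : Tendsto M (𝓝[>] 0) (𝓝 L)) (hMi : IntervalIntegrable M volume 0 X)
    (hMi' : IntervalIntegrable M' volume 0 X) :
    ∫ s in (0 : ℝ)..X, b (X - s) * M s =
      a X * L + ∫ s in (0 : ℝ)..X, a (X - s) * M' s := by
  have hac : Continuous a := continuous_iff_continuousAt.2 fun u => (ha u).continuousAt
  have h1 : IntervalIntegrable (fun s => b (X - s) * M s) volume 0 X :=
    hMi.continuousOn_mul (by fun_prop)
  have h2 : IntervalIntegrable (fun s => a (X - s) * M' s) volume 0 X :=
    hMi'.continuousOn_mul (by fun_prop)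
  have ha' : ∀ s, HasDerivAt (fun s => a (X - s)) (-b (X - s)) s := fun s =>
    (ha (X - s)).comp_const_sub X s
  -- The product `a (X - s) * M s` tends to `a X * L` at `0` and to `0` at `X`, the latter because
  -- `a 0 = 0`.
  have key := intervalIntegral.integral_eq_sub_of_hasDerivAt_of_tendsto (a := 0) (b := X)
    (f := fun s => a (X - s) * M s) (f' := fun s => a (X - s) * M' s - b (X - s) * M s)
    (fa := a X * L) (fb := 0) hX
    (fun s hs => ((ha' s).fun_mul (hM s hs.1)).congr_deriv (by ring)) (h2.sub h1) ?_ ?_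
  · rw [intervalIntegral.integral_sub h2 h1] at key
    linarith
  · refine Tendsto.mul ?_ hL
    have : Tendsto (fun s => a (X - s)) (𝓝 0) (𝓝 (a (X - 0))) :=
      (by fun_prop : Continuous fun s => a (X - s)).tendsto 0
    rw [sub_zero] at this
    exact this.mono_left nhdsWithin_le_nhds
  · have : ContinuousAt (fun s => a (X - s) * M s) X :=
      (by fun_prop : Continuous fun s => a (X - s)).continuousAt.mul (hM X hX).continuousAt
    have h3 := this.tendsto
    simp only [sub_self, ha0, zero_mul] at h3
    exact h3.mono_left nhdsWithin_le_nhds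

/-- The boundary term of the integration by parts in `s` is exactly `B_{in}`. In what remains `D_n`
falls on `E` and `D_i` on the Gaussian, so the roles of the two indices are exchanged. -/
lemma kernelL_sub_kernelB_castSucc (hd : 1 ≤ d) (i : Fin d) (y : EuclideanSpace ℝ (Fin d))
    {X t : ℝ} (hX : 0 < X) (ht : 0 < t) :
    kernelL i.castSucc (Fin.last d) (join y X) t - kernelB i.castSucc (join y X) t =
      tangKernel (Fin.last d) i y X t := by
  have hM : ∀ s, 0 < s → HasDerivAt (fun s => gradConv i.castSucc y s t)
      (gradConv' (Fin.last d) i y s t) s := fun s hs => by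
    refine (hasDerivAt_potConv hd i y hs ht).congr_of_eventuallyEq ?_
    filter_upwards [Ioi_mem_nhds hs] with σ hσ
    exact gradConv_castSucc hd i y hσ ht
  have hL : Tendsto (fun s => gradConv i.castSucc y s t) (𝓝[>] 0) (𝓝 (potConv i y 0 t)) := by
    refine (tendsto_potConv hd i y ht).congr' ?_
    filter_upwards [self_mem_nhdsWithin] with σ hσ
    exact (gradConv_castSucc hd i y hσ ht).symm
  rw [kernelL_last _ _ hX ht, kernelB_castSucc hd y X ht, volterra_parts
    (fun u => hasDerivAt_gaussN' u t) (gaussN'_zero t) (continuous_gaussN'' t) hX hM hL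
    (intervalIntegrable_gradConv _ y ht hX.le) (intervalIntegrable_gradConv' _ i y ht hX.le),
    tangKernel]
  ring

/-- By harmonicity `D_n²E = -∑_k D_k²E`, and in each summand one tangential derivative is moved to
the Gaussian. A normal second derivative thus becomes a sum of quantities already estimated. -/
lemma hasDerivAt_gradConv_last (y : EuclideanSpace ℝ (Fin d)) {s t : ℝ}
    (hs : 0 < s) (ht : 0 < t) :
    HasDerivAt (fun s => gradConv (Fin.last d) y s t)
      (-∑ k : Fin d, gradConv' k.castSucc k y s t) s := by
  have h := (gaussBound_heatKernel (n := d) ht).hasDerivAt_param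
    (F := fun σ w => gradE (Fin.last d) (join w σ))
    (F' := fun σ w => hessE (Fin.last d) (join w σ)) (half_pos hs)
    (measurable_gradE_join _) (measurable_hessE_join _)
    (fun w => abs_gradE_join_le_rpow _ w hs le_rfl)
    (fun w _ hσ => abs_hessE_join_le_rpow _ w (half_pos hs) (half_le_of_mem_ball hσ))
    (fun w _ hσ => hasDerivAt_of_hasLineDerivAt_last (hasLineDerivAt_gradE
      (norm_pos_iff.1 (norm_join_pos w ((half_pos hs).trans_le (half_le_of_mem_ball hσ)))) _)) y
  refine h.congr_deriv ?_
  have hk : ∀ k : Fin d, gradConv' k.castSucc k y s t =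
      ∫ w, heatKernel (y - w) t * hessE k.castSucc (join w s) := fun k =>
    (integral_heatKernel_mul_deriv ht (measurable_gradE_join _ s) (measurable_hessE_join _ s)
      (fun w => abs_gradE_join_le_rpow _ w hs le_rfl)
      (fun w => abs_hessE_join_le_rpow _ w hs le_rfl) k
      (fun w => hasLineDerivAt_of_castSucc
        (hasLineDerivAt_gradE (norm_pos_iff.1 (norm_join_pos w hs)) _)) y).symm
  simp_rw [hk]
  rw [← integral_finsetSum, ← integral_neg]
  · refine integral_congr_ae (Eventually.of_forall fun w => ?_)
    have := sum_hessE (norm_pos_iff.1 (norm_join_pos w hs))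
    rw [Fin.sum_univ_castSucc] at this
    simp only
    rw [← Finset.mul_sum, ← mul_neg, eq_neg_of_add_eq_zero_right this]
  · intro k _
    exact (gaussBound_heatKernel ht).integrable (Tame.of_bounded (measurable_hessE_join _ s)
      fun w => abs_hessE_join_le_rpow _ w hs le_rfl) y

/-- The integral `∫ D_n E(u, 1) du` over the tangential variable. -/
def poissonConst (d : ℕ) : ℝ :=
  ∫ u : EuclideanSpace ℝ (Fin d), gradE (Fin.last d) (join u 1)

lemma integrable_gradE_last_one :
    Integrable fun u : EuclideanSpace ℝ (Fin d) => gradE (Fin.last d) (join u 1) := by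
  have h := (integrable_norm_join_one (d := d) (r := d + 1) (by linarith)).const_mul
    (newtonConst d * (d - 1))
  refine h.congr (Eventually.of_forall fun u => ?_)
  simp only [gradE, join_last, one_mul, neg_add']

/-- `D_nE` is homogeneous of degree `-d`, so `w = s u` cancels the Jacobian and leaves `s` only
inside the continuous Gaussian. -/
lemma gradConv_last_eq (y : EuclideanSpace ℝ (Fin d)) {s : ℝ} (t : ℝ) (hs : 0 < s) :
    gradConv (Fin.last d) y s t =
      ∫ u, heatKernel (y - s • u) t * gradE (Fin.last d) (join u 1) := by
  have h := Measure.integral_comp_smul_of_nonneg (volume : Measure (EuclideanSpace ℝ (Fin d)))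
    (fun w => heatKernel (y - w) t * gradE (Fin.last d) (join w s)) s (hR := hs.le)
  rw [finrank_euclideanSpace_fin, smul_eq_mul] at h
  have h2 : ∀ u : EuclideanSpace ℝ (Fin d), heatKernel (y - s • u) t *
      gradE (Fin.last d) (join u 1) =
      s ^ d * (heatKernel (y - s • u) t * gradE (Fin.last d) (join (s • u) s)) := by
    intro u
    have e : s ^ d * (s * s ^ (-(d : ℝ) - 1)) = 1 := by
      rw [show -(d : ℝ) - 1 = -((d + 1 : ℕ) : ℝ) by push_cast; ring, Real.rpow_neg hs.le,
        Real.rpow_natCast, pow_succ]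
      field_simp
    rw [gradE, gradE, join_last, join_last, norm_join_smul u hs.le,
      Real.mul_rpow hs.le (norm_nonneg _)]
    calc _ = s ^ d * (s * s ^ (-(d : ℝ) - 1)) * (heatKernel (y - s • u) t *
          (newtonConst d * (d - 1) * (1 * ‖join u 1‖ ^ (-(d : ℝ) - 1)))) := by rw [e]; ring
      _ = _ := by ring
  simp_rw [h2]
  rw [integral_const_mul, h, gradConv]
  field_simp

/-- `D_nE(·, s)` acts as `poissonConst d` times an approximate identity; the value of this constant
is irrelevant to the estimate. -/
lemma tendsto_gradConv_last (y : EuclideanSpace ℝ (Fin d)) {t : ℝ} (ht : 0 < t) :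
    Tendsto (fun s => gradConv (Fin.last d) y s t) (𝓝[>] 0)
      (𝓝 (heatKernel y t * poissonConst d)) := by
  have h : Tendsto (fun s : ℝ => ∫ u, heatKernel (y - s • u) t * gradE (Fin.last d) (join u 1))
      (𝓝[>] 0) (𝓝 (∫ u, heatKernel y t * gradE (Fin.last d) (join u 1))) := by
    have hc := continuous_heatKernel (n := d) ht
    refine tendsto_integral_filter_of_dominated_convergence
      (fun u => 1 / Real.sqrt (2 * Real.pi * t) ^ d * |gradE (Fin.last d) (join u 1)|)
      (Eventually.of_forall fun s => ?_) (Eventually.of_forall fun s => ?_)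
      (integrable_gradE_last_one.abs.const_mul _) (Eventually.of_forall fun u => ?_)
    · exact (by fun_prop : Continuous fun u : EuclideanSpace ℝ (Fin d) =>
        heatKernel (y - s • u) t).aestronglyMeasurable.mul
        (measurable_gradE_join _ 1).aestronglyMeasurable
    · refine Eventually.of_forall fun u => ?_
      rw [Real.norm_eq_abs, abs_mul, abs_of_nonneg (heatKernel_nonneg _ _)]
      exact mul_le_mul_of_nonneg_right (heatKernel_le _ ht) (abs_nonneg _)
    · refine Tendsto.mul_const _ (Tendsto.mono_left ?_ nhdsWithin_le_nhds)
      have := (by fun_prop : Continuous fun s : ℝ => heatKernel (y - s • u) t).tendsto 0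
      simpa using this
  rw [integral_const_mul, ← poissonConst] at h
  refine h.congr' ?_
  filter_upwards [self_mem_nhdsWithin] with s hs
  exact (gradConv_last_eq y t hs).symm

/-- Here the boundary term is a multiple of `D_nΓ`, which is in `L¹` uniformly in `X`; hence nothing
has to be subtracted and `B_{nn} = 0`. -/
lemma kernelL_last_last (y : EuclideanSpace ℝ (Fin d)) {X t : ℝ} (hX : 0 < X) (ht : 0 < t) :
    kernelL (Fin.last d) (Fin.last d) (join y X) t =
      poissonConst d * (gaussN' X t * heatKernel y t) -
        ∑ k : Fin d, tangKernel k.castSucc k y X t := by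
  have hi : ∀ k ∈ Finset.univ, IntervalIntegrable (fun s => gradConv' k.castSucc k y s t)
      volume 0 X := fun k _ => intervalIntegrable_gradConv' _ k y ht hX.le
  have hi2 : ∀ k ∈ Finset.univ, IntervalIntegrable
      (fun s => gaussN' (X - s) t * gradConv' k.castSucc k y s t) volume 0 X := fun k hk => by
    have hc := continuous_gaussN' t
    exact (hi k hk).continuousOn_mul (by fun_prop)
  have hs := (IntervalIntegrable.sum Finset.univ hi).neg
  rw [kernelL_last _ _ hX ht, volterra_parts
    (fun u => hasDerivAt_gaussN' u t) (gaussN'_zero t) (continuous_gaussN'' t) hX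
    (fun s hs => hasDerivAt_gradConv_last y hs ht) (tendsto_gradConv_last y ht)
    (intervalIntegrable_gradConv _ y ht hX.le) (hs.congr fun s _ => by simp)]
  simp_rw [mul_neg, Finset.mul_sum]
  rw [intervalIntegral.integral_neg, intervalIntegral.integral_finsetSum hi2]
  simp only [tangKernel]
  ring

end Normal

/-! ### The `L¹` estimates -/

section Estimates

variable {d : ℕ}

lemma gradConv'_eq (i : Fin (d + 1)) (j : Fin d) (y : EuclideanSpace ℝ (Fin d)) {s t : ℝ}
    (hs : 0 < s) (ht : 0 < t) :
    gradConv' i j y s t =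
      ∫ v, gradHeat j v t * (gradE i (join (y - v) s) - gradE i (join y s)) := by
  have h1 := integral_sub_left_eq_self
    (fun w => gradHeat j (y - w) t * gradE i (join w s)) volume y
  have h2 := ((gaussBound_gradHeat j ht).integrable (tame_gradE i hs) y).comp_sub_left y
  simp only [sub_sub_cancel] at h1 h2
  rw [gradConv', ← h1]
  simp_rw [mul_sub]
  rw [integral_sub h2 ((integrable_gradHeat j ht).mul_const _), integral_mul_const,
    integral_gradHeat, zero_mul, sub_zero]

/-- The constant in the `L¹` estimate of `D_j Γ * D_i E`. -/
def convConst (d : ℕ) : ℝ :=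
  (gradConst d * (2 * (d + 2)) * (4 * Real.sqrt 2 ^ d)) * (2 * profileConst d)

lemma convConst_nonneg : 0 ≤ convConst d := by
  have := gradConst_nonneg (d := d)
  have := profileConst_nonneg (d := d)
  unfold convConst
  positivity

lemma lintegral_profile_add {s : ℝ} (hs : 0 < s) (v : EuclideanSpace ℝ (Fin d)) :
    ∫⁻ y : EuclideanSpace ℝ (Fin d), ENNReal.ofReal (‖join (y - v) s‖ ^ (-(d : ℝ) - 1 / 2) +
      ‖join y s‖ ^ (-(d : ℝ) - 1 / 2)) =
      ENNReal.ofReal (2 * profileConst d * s ^ (-1 / 2 : ℝ)) := by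
  have h := integrable_profile (d := d) hs
  have h' := h.comp_sub_right v
  rw [← ofReal_integral_eq_lintegral_ofReal (h'.fun_add h)
    (Eventually.of_forall fun y => by simp only [Pi.zero_apply]; positivity),
    integral_add h' h,
    integral_sub_right_eq_self (fun y => ‖join y s‖ ^ (-(d : ℝ) - 1 / 2)) v, integral_profile hs]
  congr 1
  ring

/-- After the subtraction in `gradConv'_eq`, the Hölder factor `‖v‖^(1/2)` improves the Gaussian
gradient from `t^(-1/2)` to `t^(-1/4)`, and Tonelli lets the two profiles be integrated in `y`
first, each giving `s^(-1/2)`. -/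
lemma lintegral_gradConv'_le (i : Fin (d + 1)) (j : Fin d) {s t : ℝ} (hs : 0 < s) (ht : 0 < t) :
    ∫⁻ y, ‖gradConv' i j y s t‖ₑ ≤
      ENNReal.ofReal (convConst d * t ^ (-1 / 4 : ℝ) * s ^ (-1 / 2 : ℝ)) := by
  have hK := gradConst_nonneg (d := d)
  set H := gradConst d * (2 * (d + 2))
  have hH : 0 ≤ H := by positivity
  set c := H * (t ^ (-1 / 4 : ℝ) * (4 * Real.sqrt 2 ^ d)) with hc
  have hc0 : 0 ≤ c := by positivity
  have hpt : ∀ y v : EuclideanSpace ℝ (Fin d),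
      ‖gradHeat j v t * (gradE i (join (y - v) s) - gradE i (join y s))‖ₑ ≤
        ENNReal.ofReal (c * heatKernel v (2 * t)) *
        ENNReal.ofReal (‖join (y - v) s‖ ^ (-(d : ℝ) - 1 / 2) +
          ‖join y s‖ ^ (-(d : ℝ) - 1 / 2)) := by
    intro y v
    have hk := heatKernel_nonneg v (2 * t)
    rw [← ofReal_norm, ← ENNReal.ofReal_mul (by positivity)]
    refine ENNReal.ofReal_le_ofReal ?_
    rw [Real.norm_eq_abs, abs_mul]
    have h1 := abs_gradE_sub_le (norm_pos_iff.1 (norm_join_pos (y - v) hs))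
      (norm_pos_iff.1 (norm_join_pos y hs)) i
    rw [join_sub_join, sub_self, norm_join_zero, show y - v - y = -v by abel, norm_neg] at h1
    have h2 := abs_gradHeat_mul_rpow_le j v ht (α := 1 / 2) (by norm_num) (by norm_num)
    rw [show -(1 - 1 / 2 : ℝ) / 2 = -1 / 4 by norm_num] at h2
    set P := ‖join (y - v) s‖ ^ (-(d : ℝ) - 1 / 2) + ‖join y s‖ ^ (-(d : ℝ) - 1 / 2)
    have hP : 0 ≤ P := by positivity
    calc |gradHeat j v t| * |gradE i (join (y - v) s) - gradE i (join y s)|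
        ≤ |gradHeat j v t| * (H * ‖v‖ ^ (1 / 2 : ℝ) * P) := by gcongr
      _ = H * (|gradHeat j v t| * ‖v‖ ^ (1 / 2 : ℝ)) * P := by ring
      _ ≤ H * (t ^ (-1 / 4 : ℝ) * (4 * Real.sqrt 2 ^ d * heatKernel v (2 * t))) * P := by gcongr
      _ = c * heatKernel v (2 * t) * P := by rw [hc]; ring
  have hk := integrable_heatKernel (n := d) (by positivity : 0 < 2 * t)
  have hmk := (continuous_heatKernel (n := d) (by positivity : 0 < 2 * t)).measurable
  calc ∫⁻ y, ‖gradConv' i j y s t‖ₑ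
      ≤ ∫⁻ y : EuclideanSpace ℝ (Fin d), ∫⁻ v, ENNReal.ofReal (c * heatKernel v (2 * t)) *
          ENNReal.ofReal (‖join (y - v) s‖ ^ (-(d : ℝ) - 1 / 2) +
          ‖join y s‖ ^ (-(d : ℝ) - 1 / 2)) := by
        refine lintegral_mono fun y => ?_
        rw [gradConv'_eq i j y hs ht]
        exact (enorm_integral_le_lintegral_enorm _).trans (lintegral_mono (hpt y))
    _ = ∫⁻ v : EuclideanSpace ℝ (Fin d), ∫⁻ y, ENNReal.ofReal (c * heatKernel v (2 * t)) *
          ENNReal.ofReal (‖join (y - v) s‖ ^ (-(d : ℝ) - 1 / 2) +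
          ‖join y s‖ ^ (-(d : ℝ) - 1 / 2)) := by
        refine lintegral_lintegral_swap (Measurable.aemeasurable ?_)
        exact ((hmk.comp measurable_snd).const_mul c).ennreal_ofReal.mul
          (Measurable.ennreal_ofReal (by fun_prop))
    _ = ∫⁻ v : EuclideanSpace ℝ (Fin d), ENNReal.ofReal (c * heatKernel v (2 * t)) *
          ENNReal.ofReal (2 * profileConst d * s ^ (-1 / 2 : ℝ)) := by
        refine lintegral_congr fun v => ?_
        rw [lintegral_const_mul _ (Measurable.ennreal_ofReal (by fun_prop)),
          lintegral_profile_add hs]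
    _ = ENNReal.ofReal c * ENNReal.ofReal (2 * profileConst d * s ^ (-1 / 2 : ℝ)) := by
        rw [lintegral_mul_const _ (hmk.const_mul c).ennreal_ofReal,
          ← ofReal_integral_eq_lintegral_ofReal (hk.const_mul c)
          (Eventually.of_forall fun v => mul_nonneg hc0 (heatKernel_nonneg _ _)),
          integral_const_mul, integral_heatKernel (by positivity), mul_one]
    _ = _ := by
        rw [← ENNReal.ofReal_mul hc0]
        congr 1
        rw [convConst, hc]
        ring

lemma abs_gaussN'_mul_le {z t : ℝ} (hz : 0 ≤ z) (ht : 0 < t) (β : ℝ) :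
    |gaussN' z t| * t ^ (-β) ≤ z * (t ^ (-(3 / 2 + β)) * Real.exp (-z ^ 2 / (2 * t))) := by
  have h1 : 1 / Real.sqrt (2 * Real.pi * t) ≤ t ^ (-(1 / 2) : ℝ) := by
    rw [Real.rpow_neg ht.le, ← Real.sqrt_eq_rpow, ← one_div]
    refine one_div_le_one_div_of_le (Real.sqrt_pos.2 ht) (Real.sqrt_le_sqrt ?_)
    have := Real.two_le_pi
    nlinarith
  have h2 : t ^ (-(3 / 2 + β)) = t⁻¹ * t ^ (-(1 / 2) : ℝ) * t ^ (-β) := by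
    rw [← Real.rpow_neg_one, ← Real.rpow_add ht, ← Real.rpow_add ht]
    congr 1
    ring
  rw [gaussN', abs_mul, abs_neg, abs_of_nonneg (gaussN_nonneg z t), abs_of_nonneg (by positivity),
    h2, gaussN]
  calc z / t * (1 / Real.sqrt (2 * Real.pi * t) * Real.exp (-z ^ 2 / (2 * t))) * t ^ (-β)
      ≤ z / t * (t ^ (-(1 / 2) : ℝ) * Real.exp (-z ^ 2 / (2 * t))) * t ^ (-β) := by gcongr
    _ = _ := by rw [div_eq_mul_inv]; ring

/-- This is `lintegral_rpow_mul_exp_le` with `p = 3/2 + β`. It is used with `β = 1/4`, where the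
constant is `28/3`, and with `β = 0`, where it is `6`. -/
lemma lintegral_gaussN'_mul_le {z β : ℝ} (hz : 0 < z) (h0 : 0 ≤ β) (h1 : β < 1 / 2) :
    ∫⁻ t in Ioi (0 : ℝ), ENNReal.ofReal (|gaussN' z t| * t ^ (-β)) ≤
      ENNReal.ofReal ((2 / (1 / 2 - β) + 1 / (1 / 2 + β)) * z ^ (-(2 * β))) := by
  calc ∫⁻ t in Ioi (0 : ℝ), ENNReal.ofReal (|gaussN' z t| * t ^ (-β))
      ≤ ∫⁻ t in Ioi (0 : ℝ), ENNReal.ofReal z *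
          ENNReal.ofReal (t ^ (-(3 / 2 + β)) * Real.exp (-z ^ 2 / (2 * t))) := by
        refine setLIntegral_mono' measurableSet_Ioi fun t ht => ?_
        rw [← ENNReal.ofReal_mul hz.le]
        exact ENNReal.ofReal_le_ofReal (abs_gaussN'_mul_le hz.le ht β)
    _ = ENNReal.ofReal z * ∫⁻ t in Ioi (0 : ℝ),
          ENNReal.ofReal (t ^ (-(3 / 2 + β)) * Real.exp (-z ^ 2 / (2 * t))) :=
        lintegral_const_mul _ (Measurable.ennreal_ofReal (by fun_prop))
    _ ≤ ENNReal.ofReal z * ENNReal.ofReal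
          ((2 / (2 - (3 / 2 + β)) + 1 / (3 / 2 + β - 1)) * z ^ (2 - 2 * (3 / 2 + β))) := by
        gcongr
        exact lintegral_rpow_mul_exp_le (by linarith) (by linarith) hz
    _ = _ := by
        rw [← ENNReal.ofReal_mul hz.le]
        congr 1
        rw [show 2 - 2 * (3 / 2 + β) = -(2 * β) - 1 by ring, Real.rpow_sub_one hz.ne',
          show 2 - (3 / 2 + β) = 1 / 2 - β by ring, show 3 / 2 + β - 1 = 1 / 2 + β by ring]
        field_simp

/-- The constant in the `L¹` estimate of the tangential kernels. -/
def tangConst (d : ℕ) : ℝ := convConst d * (28 / 3) * 8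

lemma tangConst_nonneg : 0 ≤ tangConst d := by
  have := convConst_nonneg (d := d)
  unfold tangConst
  positivity

lemma tangKernel_eq (i : Fin (d + 1)) (j : Fin d) (y : EuclideanSpace ℝ (Fin d)) {X : ℝ}
    (hX : 0 ≤ X) (t : ℝ) :
    tangKernel i j y X t = ∫ s in Ioc 0 X, gaussN' (X - s) t * gradConv' i j y s t :=
  intervalIntegral.integral_of_le hX

lemma measurable_tangKernel (i : Fin (d + 1)) (j : Fin d) {X : ℝ} (hX : 0 ≤ X) :
    Measurable fun p : EuclideanSpace ℝ (Fin d) × ℝ => tangKernel i j p.1 X p.2 := by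
  simp_rw [tangKernel_eq i j _ hX]
  have h : Measurable fun q : (EuclideanSpace ℝ (Fin d) × ℝ) × ℝ =>
      gaussN' (X - q.2) q.1.2 * gradConv' i j q.1.1 q.2 q.1.2 :=
    (measurable_gaussN'.comp (f := fun q : (EuclideanSpace ℝ (Fin d) × ℝ) × ℝ =>
      (X - q.2, q.1.2)) (by fun_prop)).mul
      ((measurable_gradConv' i j).comp (f := fun q : (EuclideanSpace ℝ (Fin d) × ℝ) × ℝ =>
      (q.1.1, q.2, q.1.2)) (by fun_prop))
  exact h.stronglyMeasurable.integral_prod_right'.measurable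

/-- The order of integration is `y`, then `t`, then `s`: the successive bounds are `t^(-1/4)
s^(-1/2)`, then `(X - s)^(-1/2) s^(-1/2)`, then a constant free of `X`. -/
lemma lintegral_tangKernel_le (i : Fin (d + 1)) (j : Fin d) {X : ℝ} (hX : 0 < X) :
    ∫⁻ t in Ioi (0 : ℝ), ∫⁻ y, ‖tangKernel i j y X t‖ₑ ≤ ENNReal.ofReal (tangConst d) := by
  have hC := convConst_nonneg (d := d)
  have hma : ∀ t, Measurable fun s => gaussN' (X - s) t := fun t =>
    (continuous_gaussN' t).measurable.comp (by fun_prop)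
  have hmb : ∀ t, Measurable fun p : EuclideanSpace ℝ (Fin d) × ℝ => gradConv' i j p.1 p.2 t :=
    fun t => (measurable_gradConv' i j).comp (f := fun p : EuclideanSpace ℝ (Fin d) × ℝ =>
      (p.1, p.2, t)) (by fun_prop)
  have hm2 : Measurable fun p : ℝ × ℝ => |gaussN' (X - p.2) p.1| * p.1 ^ (-(1 / 4) : ℝ) := by
    have h := measurable_gaussN'.comp (f := fun p : ℝ × ℝ => (X - p.2, p.1)) (by fun_prop)
    exact h.abs.mul (by fun_prop)
  have hslice : ∀ t ∈ Ioi (0 : ℝ), ∫⁻ y, ‖tangKernel i j y X t‖ₑ ≤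
      ∫⁻ s in Ioc 0 X, ENNReal.ofReal (convConst d * s ^ (-1 / 2 : ℝ)) *
        ENNReal.ofReal (|gaussN' (X - s) t| * t ^ (-(1 / 4) : ℝ)) := by
    intro t ht
    rw [mem_Ioi] at ht
    calc ∫⁻ y, ‖tangKernel i j y X t‖ₑ
        ≤ ∫⁻ y : EuclideanSpace ℝ (Fin d), ∫⁻ s in Ioc 0 X,
            ‖gaussN' (X - s) t * gradConv' i j y s t‖ₑ := by
          refine lintegral_mono fun y => ?_
          simp only
          rw [tangKernel_eq i j y hX.le]
          exact enorm_integral_le_lintegral_enorm _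
      _ = ∫⁻ s in Ioc 0 X, ∫⁻ y : EuclideanSpace ℝ (Fin d),
            ‖gaussN' (X - s) t * gradConv' i j y s t‖ₑ := by
          refine lintegral_lintegral_swap (Measurable.aemeasurable ?_)
          exact (((hma t).comp measurable_snd).mul (hmb t)).enorm
      _ ≤ _ := by
          refine setLIntegral_mono' measurableSet_Ioc fun s hs => ?_
          have hs0 : 0 < s := hs.1
          simp_rw [enorm_mul]
          have hms : Measurable fun y => gradConv' i j y s t :=
            (hmb t).comp (f := fun y => (y, s)) (by fun_prop)
          rw [lintegral_const_mul _ hms.enorm]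
          refine (mul_le_mul_right (lintegral_gradConv'_le i j hs0 ht) _).trans_eq ?_
          rw [← ofReal_norm, ← ENNReal.ofReal_mul (norm_nonneg _),
            ← ENNReal.ofReal_mul (by positivity), Real.norm_eq_abs, neg_div]
          congr 1
          ring
  calc ∫⁻ t in Ioi (0 : ℝ), ∫⁻ y, ‖tangKernel i j y X t‖ₑ
      ≤ ∫⁻ t in Ioi (0 : ℝ), ∫⁻ s in Ioc 0 X, ENNReal.ofReal (convConst d * s ^ (-1 / 2 : ℝ)) *
        ENNReal.ofReal (|gaussN' (X - s) t| * t ^ (-(1 / 4) : ℝ)) :=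
        setLIntegral_mono' measurableSet_Ioi hslice
    _ = ∫⁻ s in Ioc 0 X, ∫⁻ t in Ioi (0 : ℝ), ENNReal.ofReal (convConst d * s ^ (-1 / 2 : ℝ)) *
        ENNReal.ofReal (|gaussN' (X - s) t| * t ^ (-(1 / 4) : ℝ)) := by
        refine lintegral_lintegral_swap (Measurable.aemeasurable ?_)
        exact (Measurable.ennreal_ofReal (by fun_prop)).mul hm2.ennreal_ofReal
    _ ≤ ∫⁻ s in Ioc 0 X, ENNReal.ofReal (convConst d * (28 / 3)) *
          ENNReal.ofReal ((X - s) ^ (-1 / 2 : ℝ) * s ^ (-1 / 2 : ℝ)) := by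
        refine lintegral_mono_ae ?_
        filter_upwards [ae_lt_of_Ioc 0 X] with s hs
        have hs0 : 0 < s := hs.1
        have hz : 0 < X - s := sub_pos.2 hs.2
        have hms : Measurable fun t => |gaussN' (X - s) t| * t ^ (-(1 / 4) : ℝ) :=
          hm2.comp (f := fun t : ℝ => (t, s)) (by fun_prop)
        rw [lintegral_const_mul _ hms.ennreal_ofReal]
        refine (mul_le_mul_right (lintegral_gaussN'_mul_le hz (by norm_num) (by norm_num))
          _).trans_eq ?_
        rw [← ENNReal.ofReal_mul (by positivity), ← ENNReal.ofReal_mul (by positivity)]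
        congr 1
        rw [show -(2 * (1 / 4) : ℝ) = -1 / 2 by norm_num]
        ring
    _ = ENNReal.ofReal (convConst d * (28 / 3)) * ∫⁻ s in Ioc 0 X,
          ENNReal.ofReal ((X - s) ^ (-1 / 2 : ℝ) * s ^ (-1 / 2 : ℝ)) :=
        lintegral_const_mul _ (Measurable.ennreal_ofReal (by fun_prop))
    _ ≤ ENNReal.ofReal (convConst d * (28 / 3)) * ENNReal.ofReal 8 := by
        gcongr
        exact lintegral_beta_le hX
    _ = _ := by rw [← ENNReal.ofReal_mul (by positivity), tangConst]

lemma lintegral_heat_le {X : ℝ} (hX : 0 < X) :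
    ∫⁻ t in Ioi (0 : ℝ), ∫⁻ y : EuclideanSpace ℝ (Fin d), ‖gaussN' X t * heatKernel y t‖ₑ ≤
      ENNReal.ofReal 6 := by
  calc ∫⁻ t in Ioi (0 : ℝ), ∫⁻ y : EuclideanSpace ℝ (Fin d), ‖gaussN' X t * heatKernel y t‖ₑ
      -- The Gaussian has mass one in `y`; the trivial power `t^(-0)` matches
      -- `lintegral_gaussN'_mul_le` at `β = 0`.
      ≤ ∫⁻ t in Ioi (0 : ℝ), ENNReal.ofReal (|gaussN' X t| * t ^ (-0 : ℝ)) := by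
        refine setLIntegral_mono' measurableSet_Ioi fun t ht => ?_
        rw [mem_Ioi] at ht
        simp_rw [enorm_mul]
        rw [lintegral_const_mul _ (continuous_heatKernel ht).measurable.enorm,
          lintegral_enorm_of_nonneg (fun y => heatKernel_nonneg y t),
          ← ofReal_integral_eq_lintegral_ofReal (integrable_heatKernel ht)
          (Eventually.of_forall fun y => heatKernel_nonneg y t), integral_heatKernel ht,
          ENNReal.ofReal_one, mul_one, neg_zero, Real.rpow_zero, mul_one,
          ← ofReal_norm, Real.norm_eq_abs]
    _ ≤ _ := lintegral_gaussN'_mul_le hX le_rfl (by norm_num)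
    _ = _ := by norm_num

/-- The function `F` on `ℝⁿ⁻¹ × (0,∞)` is integrable, with norm at most `C`. -/
def NormLe (F : EuclideanSpace ℝ (Fin d) × ℝ → ℝ) (C : ℝ) : Prop :=
  Integrable F (volume.prod (volume.restrict (Ioi 0))) ∧
    ∫ p, ‖F p‖ ∂(volume.prod (volume.restrict (Ioi 0))) ≤ C

lemma NormLe.of_lintegral {F : EuclideanSpace ℝ (Fin d) × ℝ → ℝ} {C : ℝ} (hF : Measurable F)
    (hC : 0 ≤ C) (h : ∫⁻ t in Ioi (0 : ℝ), ∫⁻ y, ‖F (y, t)‖ₑ ≤ ENNReal.ofReal C) :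
    NormLe F C := by
  have h1 : ∫⁻ p, ‖F p‖ₑ ∂(volume.prod (volume.restrict (Ioi 0))) ≤ ENNReal.ofReal C := by
    rwa [lintegral_prod_symm _ hF.enorm.aemeasurable]
  have h2 : Integrable F (volume.prod (volume.restrict (Ioi 0))) :=
    ⟨hF.aestronglyMeasurable, h1.trans_lt ENNReal.ofReal_lt_top⟩
  refine ⟨h2, ?_⟩
  rw [integral_norm_eq_lintegral_enorm hF.aestronglyMeasurable]
  exact ENNReal.toReal_le_of_le_ofReal hC h1

lemma NormLe.congr {F G : EuclideanSpace ℝ (Fin d) × ℝ → ℝ} {C : ℝ} (hF : NormLe F C)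
    (h : ∀ y t, 0 < t → F (y, t) = G (y, t)) : NormLe G C := by
  have hae : F =ᵐ[volume.prod (volume.restrict (Ioi 0))] G := by
    have h1 : ∀ᵐ p ∂((volume : Measure (EuclideanSpace ℝ (Fin d))).prod
        (volume.restrict (Ioi (0 : ℝ)))), 0 < p.2 :=
      Measure.quasiMeasurePreserving_snd.ae (ae_restrict_mem measurableSet_Ioi)
    filter_upwards [h1] with p hp
    exact h p.1 p.2 hp
  refine ⟨hF.1.congr hae, ?_⟩
  rw [← integral_congr_ae (hae.mono fun p hp => by simp only [hp] : (fun p => ‖F p‖) =ᵐ[_] _)]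
  exact hF.2

lemma NormLe.const_mul {F : EuclideanSpace ℝ (Fin d) × ℝ → ℝ} {C : ℝ} (hF : NormLe F C) (c : ℝ) :
    NormLe (fun p => c * F p) (|c| * C) := by
  refine ⟨hF.1.const_mul c, ?_⟩
  simp_rw [norm_mul]
  rw [integral_const_mul]
  exact mul_le_mul_of_nonneg_left hF.2 (abs_nonneg c)

lemma NormLe.sub {F G : EuclideanSpace ℝ (Fin d) × ℝ → ℝ} {C D : ℝ} (hF : NormLe F C)
    (hG : NormLe G D) : NormLe (fun p => F p - G p) (C + D) := by
  refine ⟨hF.1.sub hG.1, ?_⟩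
  refine (integral_mono (hF.1.sub hG.1).norm (hF.1.norm.add hG.1.norm)
    fun p => norm_sub_le _ _).trans ?_
  rw [integral_add' hF.1.norm hG.1.norm]
  exact add_le_add hF.2 hG.2

lemma NormLe.sum {ι : Type*} [Fintype ι] {F : ι → EuclideanSpace ℝ (Fin d) × ℝ → ℝ} {C : ℝ}
    (hF : ∀ k, NormLe (F k) C) : NormLe (fun p => ∑ k, F k p) (Fintype.card ι * C) := by
  have h1 := integrable_finsetSum Finset.univ fun k _ => (hF k).1
  refine ⟨h1, ?_⟩
  refine (integral_mono h1.norm (integrable_finsetSum Finset.univ fun k _ => (hF k).1.norm)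
    fun p => norm_sum_le _ _).trans ?_
  rw [integral_finsetSum _ fun k _ => (hF k).1.norm]
  refine (Finset.sum_le_sum fun k _ => (hF k).2).trans_eq ?_
  simp

lemma NormLe.integral_lt {F : EuclideanSpace ℝ (Fin d) × ℝ → ℝ} {C D : ℝ} (hF : NormLe F C)
    (h : C < D) : Integrable F (volume.prod (volume.restrict (Ioi 0))) ∧
      ∫ t in Ioi (0 : ℝ), ∫ y, |F (y, t)| < D := by
  refine ⟨hF.1, ?_⟩
  have h1 := integral_prod_symm _ hF.1.norm
  simp only [Real.norm_eq_abs] at h1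
  rw [← h1]
  exact hF.2.trans_lt h

lemma normLe_tangKernel (i : Fin (d + 1)) (j : Fin d) {X : ℝ} (hX : 0 < X) :
    NormLe (fun p => tangKernel i j p.1 X p.2) (tangConst d) :=
  .of_lintegral (measurable_tangKernel i j hX.le) tangConst_nonneg (lintegral_tangKernel_le i j hX)

lemma normLe_heat {X : ℝ} (hX : 0 < X) :
    NormLe (fun p : EuclideanSpace ℝ (Fin d) × ℝ => gaussN' X p.2 * heatKernel p.1 p.2) 6 :=
  .of_lintegral ((measurable_gaussN'.comp (f := fun p : EuclideanSpace ℝ (Fin d) × ℝ =>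
    (X, p.2)) (by fun_prop)).mul measurable_heatKernel) (by norm_num) (lintegral_heat_le hX)

end Estimates

end

end StokesHalfSpace


theorem lemma3p1 (d : ℕ) (hd : 2 ≤ d) :
    (∀ (i : Fin (d + 1)) (x : EuclideanSpace ℝ (Fin (d + 1))) (t : ℝ),
      0 < x (Fin.last d) → 0 < t →
        Integrable (fun p : ℝ × EuclideanSpace ℝ (Fin d) =>
            StokesHalfSpace.stripIntegrand i x t (StokesHalfSpace.join p.2 p.1))
          ((volume.restrict (Ioc 0 (x (Fin.last d)))).prod volume) ∧
        ∀ j : Fin (d + 1), LineDifferentiableAt ℝ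
          (fun y => StokesHalfSpace.stripPotential i y t) x (StokesHalfSpace.stdVec j)) ∧
    (∀ (x : EuclideanSpace ℝ (Fin (d + 1))) (t : ℝ),
      0 < x (Fin.last d) → 0 < t →
        Integrable (StokesHalfSpace.kappaIntegrand x t) volume ∧
        ∀ i : Fin (d + 1), i ≠ Fin.last d → LineDifferentiableAt ℝ
          (fun y => StokesHalfSpace.kappa y t) x (StokesHalfSpace.stdVec i)) ∧
    ∃ C : ℝ, 0 < C ∧
      (∀ (i : Fin (d + 1)) (j : Fin d) (xn : ℝ), 0 < xn →
        Integrable (fun p : EuclideanSpace ℝ (Fin d) × ℝ =>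
            StokesHalfSpace.kernelL i j.castSucc (StokesHalfSpace.join p.1 xn) p.2)
          (volume.prod (volume.restrict (Ioi 0))) ∧
        ∫ t in Ioi (0 : ℝ), ∫ x' : EuclideanSpace ℝ (Fin d),
          |StokesHalfSpace.kernelL i j.castSucc (StokesHalfSpace.join x' xn) t| < C) ∧
      (∀ (i : Fin (d + 1)) (xn : ℝ), 0 < xn →
        Integrable (fun p : EuclideanSpace ℝ (Fin d) × ℝ =>
            StokesHalfSpace.kernelL i (Fin.last d) (StokesHalfSpace.join p.1 xn) p.2 -
              StokesHalfSpace.kernelB i (StokesHalfSpace.join p.1 xn) p.2)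
          (volume.prod (volume.restrict (Ioi 0))) ∧
        ∫ t in Ioi (0 : ℝ), ∫ x' : EuclideanSpace ℝ (Fin d),
          |StokesHalfSpace.kernelL i (Fin.last d) (StokesHalfSpace.join x' xn) t -
            StokesHalfSpace.kernelB i (StokesHalfSpace.join x' xn) t| < C) := by
  open StokesHalfSpace in
  have hd1 : 1 ≤ d := by omega
  have hT := tangConst_nonneg (d := d)
  have hdT : 0 ≤ (d : ℝ) * tangConst d := by positivity
  have hP : 0 ≤ |poissonConst d| * 6 := by positivity
  refine ⟨fun i x t hx ht => ⟨integrable_stripIntegrand i ht hx, fun j => ?_⟩,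
    fun x t _ ht => ⟨integrable_kappaIntegrand hd1 x ht, fun i hi => ?_⟩,
    -- The sum covers both the single tangential kernels and the case `i = j = n`, with its heat
    -- term and `d` tangential kernels; the `1` makes the inequalities strict.
    |poissonConst d| * 6 + (d : ℝ) * tangConst d + tangConst d + 1, by positivity,
    fun i j X hX => ?_, fun i X hX => ?_⟩
  · refine Fin.lastCases ?_ (fun j => ?_) j
    · exact (hasLineDerivAt_stripPotential_last i ht hx).lineDifferentiableAt
    · exact (hasLineDerivAt_stripPotential_castSucc i j ht hx).lineDifferentiableAt
  · obtain ⟨j, rfl⟩ := Fin.exists_castSucc_eq.2 hi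
    exact (hasLineDerivAt_kappa hd1 x ht j).lineDifferentiableAt
  · exact ((normLe_tangKernel i j hX).congr
      (G := fun p => kernelL i j.castSucc (join p.1 X) p.2)
      fun y t ht => (kernelL_castSucc i j y hX ht).symm).integral_lt (by linarith)
  · refine Fin.lastCases ?_ (fun k => ?_) i
    · have h := ((normLe_heat (d := d) hX).const_mul (poissonConst d)).sub
        (NormLe.sum fun k : Fin d => normLe_tangKernel k.castSucc k hX)
      rw [Fintype.card_fin] at h
      exact (h.congr (G := fun p => kernelL (Fin.last d) (Fin.last d) (join p.1 X) p.2 -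
          kernelB (Fin.last d) (join p.1 X) p.2) fun y t ht => by
        rw [kernelB_last, sub_zero, kernelL_last_last y hX ht]).integral_lt (by linarith)
    · exact ((normLe_tangKernel (Fin.last d) k hX).congr
        (G := fun p => kernelL k.castSucc (Fin.last d) (join p.1 X) p.2 -
          kernelB k.castSucc (join p.1 X) p.2)
        fun y t ht => (kernelL_sub_kernelB_castSucc hd1 k y hX ht).symm).integral_lt (by linarith)
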